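/- Let $\alpha,\beta,\gamma>0$ and, for $0<c<1$, let $w_k=\frac{(\alpha)_k(\beta)_k}{(\gamma)_k\,k!}c^k$ ($k=0,1,2,\ldots$), where $(a)_k=a(a+1)\cdots(a+k-1)$. Let $p_n(x)=p_n(x;c)$ be the orthonormal polynomials for these weights: $\deg p_n=n$, $p_n$ has positive leading coefficient, and $\sum_{k\ge 0}p_n(k)p_m(k)w_k=\delta_{m,n}$; they exist and are unique. Let $$u(x)=-1+\frac{(\gamma+x-1)x}{c(\alpha+x-1)(\beta+x-1)},\qquad u(0)=-1 .$$ For every $n\ge 0$ there is a unique number $x_n=x_n(c)$ such that $$\sum_{k=0}^\infty p_n(k)p_n(k-1)\,\frac{u(z+1)-u(k)}{z+1-k}\,w_k=\frac{1-c}{c}\,\frac{z+x_n}{(z+\alpha)(z+\beta)}$$ for all real $z\notin\{-\alpha,-\beta\}\cup\{-1,0,1,2,\ldots\}$. For $n\ge 0$ put $S_n=\sum_{k=0}^{n-1}x_k$ and $\sigma_n=(c-1)S_n+Kc+L$ with $$K=\alpha\beta-\tfrac14(\alpha+\beta+n)^2,\qquad L=\tfrac14\bigl((\alpha+\beta+\gamma+1)n+\alpha^2+\beta^2-(\alpha+\beta)(\gamma+1)+2\gamma\bigr).$$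 Then $\sigma_n$, as a function of $c\in(0,1)$, is twice continuously differentiable and satisfies the $\sigma$-form of the sixth Painlevé equation $$\sigma_n'\bigl[c(c-1)\sigma_n''\bigr]^2+\bigl[\sigma_n'\bigl(2\sigma_n-(2c-1)\sigma_n'\bigr)+d_1d_2d_3d_4\bigr]^2=(\sigma_n'+d_1^2)(\sigma_n'+d_2^2)(\sigma_n'+d_3^2)(\sigma_n'+d_4^2),$$ where $'=\mathrm{d}/\mathrm{d}c$ and $$d_1=\frac{n+\alpha-\beta}{2},\quad d_2=\frac{-n+\alpha-\beta}{2},\quad d_3=\frac{n+\alpha+\beta-2}{2},\quad d_4=\frac{n+\alpha+\beta-2\gamma}{2}.$$ -/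

import Mathlib

/-- The hypergeometric weight `w_k = (α)_k (β)_k / ((γ)_k k!) * c ^ k` on the non-negative
integers, `(a)_k` being the rising factorial. -/
noncomputable def hypWeight (α β γ c : ℝ) (k : ℕ) : ℝ :=
  (ascPochhammer ℝ k).eval α * (ascPochhammer ℝ k).eval β /
    ((ascPochhammer ℝ k).eval γ * (Nat.factorial k : ℝ)) * c ^ k

/-- `p 0, p 1, …` are the orthonormal polynomials of the discrete measure with mass `w k` at the
integer `k ≥ 0`: `p n` has degree `n` and positive leading coefficient, and
`∑_k p_n(k) p_m(k) w_k = δ_{m,n}`, with (absolutely) convergent sums. -/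
structure IsOrthonormalSystem (w : ℕ → ℝ) (p : ℕ → Polynomial ℝ) : Prop where
  natDegree_eq : ∀ n, (p n).natDegree = n
  leadingCoeff_pos : ∀ n, 0 < (p n).leadingCoeff
  hasSum : ∀ n m, HasSum (fun k : ℕ => (p n).eval (k : ℝ) * (p m).eval (k : ℝ) * w k)
    (if m = n then 1 else 0)

/-- The discrete potential `u(x) = -(w(x) - w(x-1)) / w(x)`, a rational function of `x`.
At `x = 0` its value is `-1`, in accordance with the boundary condition `w(-1) = 0`; this is
also the value of the expression below at `x = 0` when `α = 1` or `β = 1`, since `0 / 0 = 0`. -/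
noncomputable def discretePotential (α β γ c x : ℝ) : ℝ :=
  -1 + (γ + x - 1) * x / (c * ((α + x - 1) * (β + x - 1)))

/-- `ξ` is the number `x_n` attached to the orthonormal polynomial `q = p_n`, i.e. the quotient
`A_n(z) / a_n = ∑_k p_n(k) p_n(k-1) (u(z+1) - u(k)) / (z+1-k) w_k` of the ladder operator
coefficient `A_n` by the recurrence coefficient `a_n` is the rational function
`(1-c)/c * (z + ξ) / ((z+α)(z+β))` of `z`. The identity is stated at those `z` where all
the terms are literally defined. -/
def IsLadderParameter (α β γ c : ℝ) (q : Polynomial ℝ) (ξ : ℝ) : Prop :=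
  ∀ z : ℝ, z ≠ -α → z ≠ -β → (∀ k : ℕ, z + 1 ≠ (k : ℝ)) →
    HasSum (fun k : ℕ => q.eval (k : ℝ) * q.eval ((k : ℝ) - 1) *
        ((discretePotential α β γ c (z + 1) - discretePotential α β γ c (k : ℝ)) /
          (z + 1 - (k : ℝ))) * hypWeight α β γ c k)
      ((1 - c) / c * ((z + ξ) / ((z + α) * (z + β))))

/-- `σ` is a (twice continuously differentiable) solution on the set `U` of the `σ`-form of the
sixth Painlevé equation with parameters `d₁, d₂, d₃, d₄`. -/
def IsSigmaPVISolutionOn (d₁ d₂ d₃ d₄ : ℝ) (σ : ℝ → ℝ) (U : Set ℝ) : Prop :=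
  ContDiffOn ℝ 2 σ U ∧
  ∀ c ∈ U,
    deriv σ c * (c * (c - 1) * deriv (deriv σ) c) ^ 2
      + (deriv σ c * (2 * σ c - (2 * c - 1) * deriv σ c) + d₁ * d₂ * d₃ * d₄) ^ 2
    = (deriv σ c + d₁ ^ 2) * (deriv σ c + d₂ ^ 2) * (deriv σ c + d₃ ^ 2) * (deriv σ c + d₄ ^ 2)

/-- `σ_n(c) = (c - 1) S_n(c) + K c + L`, where `S_n = x_0 + ⋯ + x_{n-1}`. -/
noncomputable def sigmaFn (α β γ : ℝ) (x : ℕ → ℝ → ℝ) (n : ℕ) (c : ℝ) : ℝ :=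
  (c - 1) * ∑ k ∈ Finset.range n, x k c
    + (α * β - 1 / 4 * (α + β + n) ^ 2) * c
    + 1 / 4 * ((α + β + γ + 1) * n + α ^ 2 + β ^ 2 - (α + β) * (γ + 1) + 2 * γ)

/-! Let `L c` be summation against the weight, with monic orthogonal polynomials x P_n = P_{n+1} +
b_n P_n + a_n P_{n-1} (a_n is `recA`, the square of the orthonormal coefficient) and S = b_0 + ⋯ +
b_{n-1}. Only three properties of `L` enter (`IsHypergeometricFamily`): positivity, c (d/dc) L(q) =
L(xq), and the Pearson equation, which encodes the first-order recurrence of the weight.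

The second property yields the Toda equations c b_n' = a_{n+1} - a_n, c a_n' = a_n (b_n - b_{n-1}),
c S' = a_n. The Pearson equation tested on P_n(x) P_n(x+1) yields the relation `laguerre_freud`; its
c-derivative, reduced by Toda, is a second relation, `deriv_laguerre_freud`. Together they show by
induction on n (`lax_det`) that (x² + (γ-1-n)x + U)(c x² + c(α+β+n-2)x + V) + a_n ((1-c)x +
l)((1-c)x + l') = c x(x+γ-1)(x+α-1)(x+β-1), where U, V, l, l' are `laxU`, `laxV` and the two values
of `laxOff`. The two lowest coefficients determine a_n l l' and a_n (l + l').

For σ equal to (c-1)S plus a suitable affine function, U, V and (1-c)² a_n are affine in σ and σ',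
while c² σ'' = -a_n (l - l'). Hence (l - l')² = (l + l')² - 4 l l' is a second-order equation for σ;
multiplied by σ' it is the σ-form. Finally, evaluating the ladder sum gives x_n = b_n plus an
explicit function of c (`isLadderParameter_ladderValue`), so σ_n is of this type. -/

open Polynomial Filter
open scoped Topology

/-! ### Orthogonal polynomials of a positive functional -/

namespace MomentFunctional

/-- Consecutive monic orthogonal polynomials `(P_n, P_{n-1})` of a linear functional, generated by
the three-term recurrence, with `P_{-1} = 0`. -/
noncomputable def polyPair (L : ℝ[X] →ₗ[ℝ] ℝ) : ℕ → ℝ[X] × ℝ[X]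
  | 0 => (1, 0)
  | n + 1 =>
    ((X - C (L (X * ((polyPair L n).1 * (polyPair L n).1)) /
          L ((polyPair L n).1 * (polyPair L n).1))) * (polyPair L n).1
      - C (L ((polyPair L n).1 * (polyPair L n).1) /
          L ((polyPair L n).2 * (polyPair L n).2)) * (polyPair L n).2, (polyPair L n).1)

/-- The monic orthogonal polynomial of degree `n`. -/
noncomputable def poly (L : ℝ[X] →ₗ[ℝ] ℝ) (n : ℕ) : ℝ[X] := (polyPair L n).1

/-- The monic orthogonal polynomial of degree `n - 1`, which is `0` for `n = 0`. -/
noncomputable def prev (L : ℝ[X] →ₗ[ℝ] ℝ) (n : ℕ) : ℝ[X] := (polyPair L n).2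

/-- The squared norm `h_n = L (P_n ^ 2)`. -/
noncomputable def normSq (L : ℝ[X] →ₗ[ℝ] ℝ) (n : ℕ) : ℝ := L (poly L n * poly L n)

/-- The recurrence coefficient `a_n ^ 2 = h_n / h_{n-1}`, which is `0` for `n = 0`. -/
noncomputable def recA (L : ℝ[X] →ₗ[ℝ] ℝ) (n : ℕ) : ℝ := normSq L n / L (prev L n * prev L n)

/-- The recurrence coefficient `b_n`. -/
noncomputable def recB (L : ℝ[X] →ₗ[ℝ] ℝ) (n : ℕ) : ℝ :=
  L (X * (poly L n * poly L n)) / normSq L n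

/-- The recurrence coefficient `b_{n-1}`, which is `0` for `n = 0`. -/
noncomputable def prevB (L : ℝ[X] →ₗ[ℝ] ℝ) (n : ℕ) : ℝ :=
  L (X * (prev L n * prev L n)) / L (prev L n * prev L n)

/-- The sum `b_0 + ⋯ + b_{n-1}`. -/
noncomputable def sumB (L : ℝ[X] →ₗ[ℝ] ℝ) (n : ℕ) : ℝ := ∑ j ∈ Finset.range n, recB L j

variable (L : ℝ[X] →ₗ[ℝ] ℝ)

@[simp] lemma poly_zero : poly L 0 = 1 := rfl
@[simp] lemma prev_zero : prev L 0 = 0 := rfl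
@[simp] lemma prev_succ (n : ℕ) : prev L (n + 1) = poly L n := rfl
@[simp] lemma recA_zero : recA L 0 = 0 := by simp [recA]
lemma recA_succ (n : ℕ) : recA L (n + 1) = normSq L (n + 1) / normSq L n := rfl
@[simp] lemma prevB_succ (n : ℕ) : prevB L (n + 1) = recB L n := rfl

lemma poly_succ (n : ℕ) :
    poly L (n + 1) = (X - C (recB L n)) * poly L n - C (recA L n) * prev L n := rfl

lemma sumB_succ (n : ℕ) : sumB L (n + 1) = sumB L n + recB L n := by
  simp [sumB, Finset.sum_range_succ]

@[simp] lemma sumB_zero : sumB L 0 = 0 := by simp [sumB]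

lemma X_mul_poly (n : ℕ) :
    X * poly L n = poly L (n + 1) + C (recB L n) * poly L n + C (recA L n) * prev L n := by
  rw [poly_succ]; ring

lemma monic_natDegree_poly (n : ℕ) :
    ((poly L n).Monic ∧ (poly L n).natDegree = n) ∧ (prev L n).degree < (n : WithBot ℕ) := by
  induction n with
  | zero => simp
  | succ n ih =>
    obtain ⟨⟨hm, hd⟩, hq⟩ := ih
    have hXm : ((X - C (recB L n)) * poly L n).Monic := (monic_X_sub_C _).mul hm
    have hXd : ((X - C (recB L n)) * poly L n).degree = ((n + 1 : ℕ) : WithBot ℕ) := by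
      rw [degree_mul, degree_X_sub_C, degree_eq_natDegree hm.ne_zero, hd]
      push_cast; ring
    have hlt : (C (recA L n) * prev L n).degree < ((X - C (recB L n)) * poly L n).degree := by
      rw [hXd]
      rw [← smul_eq_C_mul]
      refine lt_of_le_of_lt (degree_smul_le _ _) (hq.trans ?_)
      exact_mod_cast Nat.lt_succ_self n
    refine ⟨⟨?_, ?_⟩, ?_⟩
    · rw [poly_succ]; exact hXm.sub_of_left hlt
    · rw [poly_succ]
      apply natDegree_eq_of_degree_eq_some
      rw [degree_sub_eq_left_of_degree_lt hlt, hXd]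
    · rw [prev_succ, degree_eq_natDegree hm.ne_zero, hd]
      exact_mod_cast Nat.lt_succ_self n

lemma monic_poly (n : ℕ) : (poly L n).Monic := (monic_natDegree_poly L n).1.1
lemma natDegree_poly (n : ℕ) : (poly L n).natDegree = n := (monic_natDegree_poly L n).1.2
lemma degree_prev_lt (n : ℕ) : (prev L n).degree < (n : WithBot ℕ) := (monic_natDegree_poly L n).2

lemma coeff_poly_self (n : ℕ) : (poly L n).coeff n = 1 := by
  have := monic_poly L n
  rwa [Monic, leadingCoeff, natDegree_poly] at this

lemma coeff_poly_of_lt {n m : ℕ} (h : n < m) : (poly L n).coeff m = 0 :=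
  coeff_eq_zero_of_natDegree_lt (by rwa [natDegree_poly])

lemma coeff_prev_of_le {n m : ℕ} (h : n ≤ m) : (prev L n).coeff m = 0 :=
  coeff_eq_zero_of_degree_lt ((degree_prev_lt L n).trans_le (by exact_mod_cast h))

/-- The subleading coefficient of `P_n` is `-(b_0 + ⋯ + b_{n-1})`. -/
lemma coeff_X_mul_poly (n : ℕ) : (X * poly L n).coeff n = -sumB L n := by
  induction n with
  | zero => simp
  | succ n ih =>
    have h : poly L (n + 1) = X * poly L n - C (recB L n) * poly L n
      - C (recA L n) * prev L n := by rw [poly_succ]; ring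
    rw [coeff_X_mul, h, coeff_sub, coeff_sub, ih, coeff_C_mul, coeff_C_mul, coeff_poly_self,
      coeff_prev_of_le L le_rfl, sumB_succ]
    ring

lemma map_C_mul (r : ℝ) (q : ℝ[X]) : L (C r * q) = r * L q := by
  rw [← smul_eq_C_mul, map_smul, smul_eq_mul]

lemma normSq_pos {L : ℝ[X] →ₗ[ℝ] ℝ} (hL : ∀ p : ℝ[X], p ≠ 0 → 0 < L (p * p)) (n : ℕ) :
    0 < normSq L n := hL _ (monic_poly L n).ne_zero

lemma map_poly_succ_mul (n : ℕ) (q : ℝ[X]) :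
    L (poly L (n + 1) * q) = L (poly L n * (X * q)) - recB L n * L (poly L n * q)
      - recA L n * L (prev L n * q) := by
  rw [← map_C_mul, ← map_C_mul, ← map_sub, ← map_sub, poly_succ]
  congr 1; ring

lemma map_mul_X_poly (q : ℝ[X]) (n : ℕ) :
    L (q * (X * poly L n)) = L (q * poly L (n + 1)) + recB L n * L (q * poly L n)
      + recA L n * L (q * prev L n) := by
  rw [← map_C_mul, ← map_C_mul, ← map_add, ← map_add, X_mul_poly]
  congr 1; ring

variable {L}

/-- Pairing P_{n+1} with P_j through the recurrence, the value of b_n settles j = n, the value of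
a_n settles j = n - 1, and smaller j follow from earlier orthogonality. -/
lemma orthogonal_le (hL : ∀ p : ℝ[X], p ≠ 0 → 0 < L (p * p)) (n : ℕ) :
    ∀ m ≤ n, ∀ j < m, L (poly L m * poly L j) = 0 := by
  induction n with
  | zero => intro m hm j hj; omega
  | succ n ih =>
    intro m hm j hj
    rcases Nat.lt_or_ge m (n + 1) with h | h
    · exact ih m (by omega) j hj
    obtain rfl : m = n + 1 := by omega
    have hn := (normSq_pos hL n).ne'
    rw [map_poly_succ_mul]
    rcases Nat.lt_or_ge j n with h1 | h1
    · obtain ⟨k, rfl⟩ : ∃ k, n = k + 1 := ⟨n - 1, by omega⟩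
      have hprev : L (poly L (k + 1) * prev L j) = 0 := by
        cases j with
        | zero => simp
        | succ j => exact ih _ le_rfl j (by omega)
      rw [map_mul_X_poly, hprev, ih _ le_rfl j h1, prev_succ]
      rcases Nat.lt_or_ge j k with h2 | h2
      · rw [ih _ le_rfl (j + 1) (by omega), ih k (by omega) j h2]; ring
      · obtain rfl : j = k := by omega
        have hj := (normSq_pos hL j).ne'
        rw [recA_succ]
        change normSq L (j + 1) + _ + _ - _ - _ * normSq L j = 0
        field_simp
        ring
    · obtain rfl : j = n := by omega
      have hprev : L (prev L j * poly L j) = 0 := by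
        cases j with
        | zero => simp
        | succ j => rw [mul_comm]; exact ih _ le_rfl j (by omega)
      rw [hprev, recB, show poly L j * (X * poly L j) = X * (poly L j * poly L j) by ring]
      change _ - _ * normSq L j - _ = 0
      field_simp
      ring

lemma map_poly_mul_of_degree_lt (hL : ∀ p : ℝ[X], p ≠ 0 → 0 < L (p * p)) (n : ℕ) :
    ∀ q : ℝ[X], q.degree < (n : WithBot ℕ) → L (poly L n * q) = 0 := by
  suffices H : ∀ m ≤ n, ∀ q : ℝ[X], q.degree < (m : WithBot ℕ) → L (poly L n * q) = 0 from
    H n le_rfl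
  intro m
  induction m with
  | zero =>
    intro _ q hq
    have : q = 0 := by
      rw [← degree_eq_bot]
      exact Nat.WithBot.lt_zero_iff.1 (by simpa using hq)
    simp [this]
  | succ m ih =>
    intro hm q hq
    have key : (q - C (q.coeff m) * poly L m).degree < (m : WithBot ℕ) := by
      rw [degree_lt_iff_coeff_zero] at hq ⊢
      intro k hk
      rcases hk.lt_or_eq with h | h
      · rw [coeff_sub, coeff_C_mul, hq k (by omega), coeff_poly_of_lt L h]; ring
      · subst h; rw [coeff_sub, coeff_C_mul, coeff_poly_self]; ring
    have e : L (poly L n * q) = L (poly L n * (q - C (q.coeff m) * poly L m))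
        + q.coeff m * L (poly L n * poly L m) := by
      rw [← map_C_mul, ← map_add]; congr 1; ring
    rw [e, ih (by omega) _ key, orthogonal_le hL n n le_rfl m (by omega)]
    ring

lemma map_poly_mul_prev (hL : ∀ p : ℝ[X], p ≠ 0 → 0 < L (p * p)) (n : ℕ) :
    L (poly L n * prev L n) = 0 :=
  map_poly_mul_of_degree_lt hL n _ (degree_prev_lt L n)

lemma map_poly_mul_poly_succ (hL : ∀ p : ℝ[X], p ≠ 0 → 0 < L (p * p)) (n : ℕ) :
    L (poly L n * poly L (n + 1)) = 0 := by
  rw [mul_comm]; exact map_poly_mul_prev hL (n + 1)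

/-- Pairing of `P_n` with a polynomial of degree at most `n`. -/
lemma map_poly_mul_of_natDegree_le (hL : ∀ p : ℝ[X], p ≠ 0 → 0 < L (p * p)) {n : ℕ} {q : ℝ[X]}
    (hq : q.natDegree ≤ n) : L (poly L n * q) = normSq L n * q.coeff n := by
  have key : (q - C (q.coeff n) * poly L n).degree < (n : WithBot ℕ) := by
    rw [degree_lt_iff_coeff_zero]
    intro k hk
    rcases hk.lt_or_eq with h | h
    · rw [coeff_sub, coeff_C_mul, coeff_eq_zero_of_natDegree_lt (hq.trans_lt h),
        coeff_poly_of_lt L h]; ring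
    · subst h; rw [coeff_sub, coeff_C_mul, coeff_poly_self]; ring
  have e : L (poly L n * q) = L (poly L n * (q - C (q.coeff n) * poly L n))
      + q.coeff n * L (poly L n * poly L n) := by
    rw [← map_C_mul, ← map_add]; congr 1; ring
  rw [e, map_poly_mul_of_degree_lt hL n _ key, normSq]
  ring

/-- Pairing of `P_n` with a polynomial of degree at most `n + 1`. -/
lemma map_poly_mul_of_natDegree_le_succ (hL : ∀ p : ℝ[X], p ≠ 0 → 0 < L (p * p)) {n : ℕ}
    {q : ℝ[X]} (hq : q.natDegree ≤ n + 1) :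
    L (poly L n * q) = normSq L n * (q.coeff n + q.coeff (n + 1) * sumB L (n + 1)) := by
  have hc : (poly L (n + 1)).coeff n = -sumB L (n + 1) := by
    rw [← coeff_X_mul_poly, coeff_X_mul]
  have key : (q - C (q.coeff (n + 1)) * poly L (n + 1)).natDegree ≤ n := by
    rw [natDegree_le_iff_coeff_eq_zero]
    intro k hk
    rcases (show n + 1 ≤ k from hk).lt_or_eq with h | h
    · rw [coeff_sub, coeff_C_mul, coeff_eq_zero_of_natDegree_lt (hq.trans_lt h),
        coeff_poly_of_lt L h]; ring
    · subst h; rw [coeff_sub, coeff_C_mul, coeff_poly_self]; ring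
  have e : L (poly L n * q) = L (poly L n * (q - C (q.coeff (n + 1)) * poly L (n + 1)))
      + q.coeff (n + 1) * L (poly L n * poly L (n + 1)) := by
    rw [← map_C_mul, ← map_add]; congr 1; ring
  rw [e, map_poly_mul_of_natDegree_le hL key, map_poly_mul_poly_succ hL, coeff_sub, coeff_C_mul,
    hc]
  ring

/-- The spare factor a_n keeps this valid at n = 0, where a_0 h_{-1} = h_0 would read 0 = h_0. -/
lemma recA_mul_map_prev (hL : ∀ p : ℝ[X], p ≠ 0 → 0 < L (p * p)) (n : ℕ) :
    recA L n ^ 2 * L (prev L n * prev L n) = recA L n * normSq L n := by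
  cases n with
  | zero => simp
  | succ n =>
    have hn := (normSq_pos hL n).ne'
    rw [recA_succ, prev_succ]
    change _ * normSq L n = _
    field_simp

lemma recA_succ_mul (hL : ∀ p : ℝ[X], p ≠ 0 → 0 < L (p * p)) (n : ℕ) :
    recA L (n + 1) * normSq L n = normSq L (n + 1) := by
  have hn := (normSq_pos hL n).ne'
  rw [recA_succ]; field_simp

lemma recB_mul (hL : ∀ p : ℝ[X], p ≠ 0 → 0 < L (p * p)) (n : ℕ) :
    L (X * (poly L n * poly L n)) = recB L n * normSq L n := by
  have hn := (normSq_pos hL n).ne'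
  rw [recB]; field_simp

/-- The second moment of `P_n ^ 2`. -/
lemma map_X_sq_mul_poly_sq (hL : ∀ p : ℝ[X], p ≠ 0 → 0 < L (p * p)) (n : ℕ) :
    L (poly L n * (X ^ 2 * poly L n)) =
      normSq L n * (recA L (n + 1) + recB L n ^ 2 + recA L n) := by
  have e : poly L n * (X ^ 2 * poly L n) = (X * poly L n) * (X * poly L n) := by ring
  rw [e, map_mul_X_poly, mul_comm (X * _) (poly L (n + 1)), mul_comm (X * _) (poly L n),
    mul_comm (X * _) (prev L n), map_mul_X_poly, map_mul_X_poly, map_mul_X_poly,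
    map_poly_mul_poly_succ hL, map_poly_mul_prev hL, mul_comm (poly L (n + 1)) (poly L n),
    map_poly_mul_poly_succ hL, mul_comm (prev L n) (poly L n), map_poly_mul_prev hL]
  have h1 : L (poly L (n + 1) * prev L n) = 0 :=
    map_poly_mul_of_degree_lt hL _ _ ((degree_prev_lt L n).trans (by exact_mod_cast n.lt_succ_self))
  rw [h1, mul_comm (prev L n), h1]
  have h2 := recA_mul_map_prev hL n
  have h3 := recA_succ_mul hL n
  simp only [normSq] at h2 h3 ⊢
  linear_combination h2 - h3

/-- Pairing of `P_n` with a polynomial of degree at most `n + 2`. -/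
lemma map_poly_mul_of_natDegree_le_add_two (hL : ∀ p : ℝ[X], p ≠ 0 → 0 < L (p * p)) {n : ℕ}
    {q : ℝ[X]} (hq : q.natDegree ≤ n + 2) :
    L (poly L n * q) = normSq L n *
      (q.coeff (n + 2) * (recA L (n + 1) + recB L n ^ 2 + recA L n)
        + (q.coeff (n + 1) + q.coeff (n + 2) * sumB L n) * sumB L (n + 1)
        + q.coeff n - q.coeff (n + 2) * (X ^ 2 * poly L n).coeff n) := by
  have hc1 : (X ^ 2 * poly L n).coeff (n + 1) = -sumB L n := by
    rw [pow_two, mul_assoc, coeff_X_mul, coeff_X_mul_poly]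
  have hc2 : (X ^ 2 * poly L n).coeff (n + 2) = 1 := by
    rw [coeff_X_pow_mul, coeff_poly_self]
  have key : (q - C (q.coeff (n + 2)) * (X ^ 2 * poly L n)).natDegree ≤ n + 1 := by
    rw [natDegree_le_iff_coeff_eq_zero]
    intro k hk
    rcases (show n + 2 ≤ k from hk).lt_or_eq with h | h
    · obtain ⟨j, rfl⟩ : ∃ j, k = j + 2 := ⟨k - 2, by omega⟩
      rw [coeff_sub, coeff_C_mul, coeff_eq_zero_of_natDegree_lt (hq.trans_lt h),
        coeff_X_pow_mul, coeff_poly_of_lt L (by omega)]; ring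
    · subst h; rw [coeff_sub, coeff_C_mul, hc2]; ring
  have e : L (poly L n * q) = L (poly L n * (q - C (q.coeff (n + 2)) * (X ^ 2 * poly L n)))
      + q.coeff (n + 2) * L (poly L n * (X ^ 2 * poly L n)) := by
    rw [← map_C_mul, ← map_add]; congr 1; ring
  rw [e, map_poly_mul_of_natDegree_le_succ hL key, map_X_sq_mul_poly_sq hL, coeff_sub, coeff_sub,
    coeff_C_mul, coeff_C_mul, hc1]
  ring

end MomentFunctional

/-! ### Shifted polynomials and the Laguerre–Freud relation -/

namespace MomentFunctional

lemma coeff_comp_X_add_C {F : ℝ[X]} {N : ℕ} (hF : F.natDegree < N) (r : ℝ) (m : ℕ) :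
    (F.comp (X + C r)).coeff m =
      ∑ i ∈ Finset.range N, F.coeff i * (r ^ (i - m) * (i.choose m : ℝ)) := by
  rw [comp, eval₂_eq_sum_range' C hF, finsetSum_coeff]
  refine Finset.sum_congr rfl fun i _ => ?_
  rw [coeff_C_mul, coeff_X_add_C_pow]

lemma natDegree_comp_X_add_C_le {F : ℝ[X]} {N : ℕ} (hF : F.natDegree ≤ N) (r : ℝ) :
    (F.comp (X + C r)).natDegree ≤ N := by
  rw [natDegree_comp, natDegree_X_add_C, mul_one]; exact hF

lemma coeff_comp_top {F : ℝ[X]} {n : ℕ} (hF : F.natDegree ≤ n) (r : ℝ) :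
    (F.comp (X + C r)).coeff n = F.coeff n := by
  rw [coeff_comp_X_add_C (Nat.lt_succ_of_le hF), Finset.sum_range_succ,
    Finset.sum_eq_zero]
  · simp
  · intro i hi
    rw [Nat.choose_eq_zero_of_lt (Finset.mem_range.1 hi)]; simp

lemma coeff_comp_top_sub_one {F : ℝ[X]} {n : ℕ} (hF : F.natDegree ≤ n + 1) (r : ℝ) :
    (F.comp (X + C r)).coeff n = F.coeff n + (n + 1) * r * F.coeff (n + 1) := by
  rw [coeff_comp_X_add_C (Nat.lt_succ_of_le hF), Finset.sum_range_succ, Finset.sum_range_succ,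
    Finset.sum_eq_zero]
  · simp; ring
  · intro i hi
    rw [Nat.choose_eq_zero_of_lt (Finset.mem_range.1 hi)]; simp

lemma coeff_comp_top_sub_two {F : ℝ[X]} {n : ℕ} (hF : F.natDegree ≤ n + 2) (r : ℝ) :
    (F.comp (X + C r)).coeff n = F.coeff n + (n + 1) * r * F.coeff (n + 1)
      + (n + 2) * (n + 1) / 2 * r ^ 2 * F.coeff (n + 2) := by
  have hch : ((n + 2).choose n : ℝ) = (n + 2) * (n + 1) / 2 := by
    rw [Nat.choose_symm_add, Nat.cast_choose_two]; push_cast; ring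
  rw [coeff_comp_X_add_C (Nat.lt_succ_of_le hF), Finset.sum_range_succ, Finset.sum_range_succ,
    Finset.sum_range_succ, Finset.sum_eq_zero, hch]
  · simp; ring
  · intro i hi
    rw [Nat.choose_eq_zero_of_lt (Finset.mem_range.1 hi)]; simp

variable {L : ℝ[X] →ₗ[ℝ] ℝ}

lemma comp_X_add_C_neg (q : ℝ[X]) (r : ℝ) : (q.comp (X + C r)).comp (X + C (-r)) = q := by
  rw [comp_assoc]; simp

lemma map_poly_mul_comp (hL : ∀ p : ℝ[X], p ≠ 0 → 0 < L (p * p)) (n : ℕ) (r : ℝ) :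
    L (poly L n * (poly L n).comp (X + C r)) = normSq L n := by
  have h : (poly L n).natDegree ≤ n := (natDegree_poly L n).le
  rw [map_poly_mul_of_natDegree_le hL (natDegree_comp_X_add_C_le h r), coeff_comp_top h,
    coeff_poly_self, mul_one]

/-- The second factor is the shift by r of (x - r) P_n. Only its two top coefficients pair with P_n,
and the difference of consecutive sums S leaves b_n. -/
lemma map_X_mul_poly_mul_comp (hL : ∀ p : ℝ[X], p ≠ 0 → 0 < L (p * p)) (n : ℕ) (r : ℝ) :
    L (X * (poly L n * (poly L n).comp (X + C r))) = normSq L n * (recB L n + r * n) := by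
  set F : ℝ[X] := X * poly L n - C r * poly L n with hFdef
  have hc1 : F.coeff (n + 1) = 1 := by
    rw [hFdef, coeff_sub, coeff_C_mul, coeff_X_mul, coeff_poly_self,
      coeff_poly_of_lt L n.lt_succ_self]; ring
  have hc0 : F.coeff n = -sumB L n - r := by
    rw [hFdef, coeff_sub, coeff_C_mul, coeff_X_mul_poly, coeff_poly_self]; ring
  have hF : F.natDegree ≤ n + 1 := by
    rw [natDegree_le_iff_coeff_eq_zero]
    intro k hk
    obtain ⟨j, rfl⟩ : ∃ j, k = j + 1 := ⟨k - 1, by omega⟩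
    rw [hFdef, coeff_sub, coeff_C_mul, coeff_X_mul, coeff_poly_of_lt L (by omega),
      coeff_poly_of_lt L (by omega)]; ring
  have e : X * (poly L n * (poly L n).comp (X + C r)) = poly L n * F.comp (X + C r) := by
    rw [hFdef]; simp only [sub_comp, mul_comp, X_comp, C_comp]; ring
  rw [e, map_poly_mul_of_natDegree_le_succ hL (natDegree_comp_X_add_C_le hF r),
    coeff_comp_top hF, coeff_comp_top_sub_one hF, hc1, hc0, sumB_succ]
  ring

/-- Three top coefficients matter here. The third involves the coefficient of x^{n-2} in P_n, which
is not otherwise known, but it enters twice with opposite signs and cancels. -/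
lemma map_quadratic_mul_poly_mul_comp (hL : ∀ p : ℝ[X], p ≠ 0 → 0 < L (p * p)) (n : ℕ)
    (r s t : ℝ) :
    L (poly L n * ((X ^ 2 + C s * X + C t) * poly L n).comp (X + C r)) = normSq L n *
      (recA L (n + 1) + recB L n ^ 2 + recA L n + (s + (n + 2) * r) * sumB L (n + 1)
        - s * sumB L n + t + (n + 1) * r * (s - sumB L n) + (n + 2) * (n + 1) / 2 * r ^ 2) := by
  set F : ℝ[X] := (X ^ 2 + C s * X + C t) * poly L n with hFdef
  have hFe : F = X ^ 2 * poly L n + C s * (X * poly L n) + C t * poly L n := by rw [hFdef]; ring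
  have hc2 : F.coeff (n + 2) = 1 := by
    rw [hFe, coeff_add, coeff_add, coeff_C_mul, coeff_C_mul, coeff_X_mul, coeff_X_pow_mul,
      coeff_poly_self, coeff_poly_of_lt L (by omega), coeff_poly_of_lt L (by omega)]; ring
  have hc1 : F.coeff (n + 1) = -sumB L n + s := by
    rw [hFe, coeff_add, coeff_add, coeff_C_mul, coeff_C_mul, pow_two, mul_assoc, coeff_X_mul,
      coeff_X_mul, coeff_X_mul_poly, coeff_poly_self, coeff_poly_of_lt L (by omega)]; ring
  have hc0 : F.coeff n = (X ^ 2 * poly L n).coeff n - s * sumB L n + t := by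
    rw [hFe, coeff_add, coeff_add, coeff_C_mul, coeff_C_mul, coeff_X_mul_poly, coeff_poly_self]
    ring
  have hF : F.natDegree ≤ n + 2 := by
    rw [natDegree_le_iff_coeff_eq_zero]
    intro k hk
    obtain ⟨j, rfl⟩ : ∃ j, k = j + 2 := ⟨k - 2, by omega⟩
    rw [hFe, coeff_add, coeff_add, coeff_C_mul, coeff_C_mul, coeff_X_mul, coeff_X_pow_mul,
      coeff_poly_of_lt L (by omega), coeff_poly_of_lt L (by omega),
      coeff_poly_of_lt L (by omega)]; ring
  rw [map_poly_mul_of_natDegree_le_add_two hL (natDegree_comp_X_add_C_le hF r),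
    coeff_comp_top hF, coeff_comp_top_sub_one hF, coeff_comp_top_sub_two (n := n) hF, hc2, hc1, hc0]
  push_cast
  ring

/-- The Laguerre–Freud relation of a functional that satisfies the Pearson equation of the
hypergeometric weight. -/
lemma laguerre_freud (hL : ∀ p : ℝ[X], p ≠ 0 → 0 < L (p * p)) {α β γ c : ℝ}
    (hP : ∀ f : ℝ[X], L (X * (X + C (γ - 1)) * f.comp (X + C (-1))) =
      c * L ((X + C α) * (X + C β) * f)) (n : ℕ) :
    (1 - c) * (recA L (n + 1) + recA L n + recB L n ^ 2) + (γ - 1 - n) * recB L n - n * (γ - 1)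
        + n * (n - 1) / 2 - sumB L n =
      c * ((α + β + n) * recB L n + α * β + n * (α + β) + n * (n - 1) / 2 + sumB L n) := by
  -- With this test function both sides of the Pearson equation become P_n times a shift of
  -- (quadratic) · P_n: by -1 on the left, by +1 on the right.
  have h := hP (poly L n * (poly L n).comp (X + C 1))
  have e1 : X * (X + C (γ - 1)) * (poly L n * (poly L n).comp (X + C 1)).comp (X + C (-1)) =
      poly L n * ((X ^ 2 + C (γ + 1) * X + C γ) * poly L n).comp (X + C (-1)) := by
    rw [mul_comp, comp_X_add_C_neg]
    simp only [mul_comp, add_comp, pow_comp, X_comp, C_comp]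
    simp only [C_add, C_sub, C_neg, C_1]
    ring
  have e2 : (X + C α) * (X + C β) * (poly L n * (poly L n).comp (X + C 1)) =
      poly L n * ((X ^ 2 + C (α + β - 2) * X + C ((α - 1) * (β - 1))) * poly L n).comp
        (X + C 1) := by
    have : (C 2 : ℝ[X]) = 2 := rfl
    simp only [mul_comp, add_comp, pow_comp, X_comp, C_comp]
    simp only [C_add, C_sub, C_mul, C_1, this]
    ring
  rw [e1, e2, map_quadratic_mul_poly_mul_comp hL, map_quadratic_mul_poly_mul_comp hL,
    sumB_succ] at h
  have hn := (normSq_pos hL n).ne'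
  refine mul_left_cancel₀ hn ?_
  linear_combination h

end MomentFunctional

/-! ### Differentiation in c and the Toda equations -/

/-- `P'` is the coefficientwise derivative at `c` of the family of polynomials `P`. -/
def HasCoeffDerivAt (P : ℝ → ℝ[X]) (P' : ℝ[X]) (c : ℝ) : Prop :=
  ∀ j, HasDerivAt (fun t => (P t).coeff j) (P'.coeff j) c

namespace HasCoeffDerivAt

variable {P Q : ℝ → ℝ[X]} {P' Q' : ℝ[X]} {c : ℝ}

lemma const (p : ℝ[X]) (c : ℝ) : HasCoeffDerivAt (fun _ => p) 0 c := fun j => by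
  simpa using hasDerivAt_const c (p.coeff j)

lemma C_of_hasDerivAt {f : ℝ → ℝ} {f' : ℝ} (h : HasDerivAt f f' c) :
    HasCoeffDerivAt (fun t => C (f t)) (C f') c := fun j => by
  simp only [coeff_C]
  split_ifs
  · exact h
  · exact hasDerivAt_const _ _

lemma sub (hP : HasCoeffDerivAt P P' c) (hQ : HasCoeffDerivAt Q Q' c) :
    HasCoeffDerivAt (fun t => P t - Q t) (P' - Q') c := fun j => by
  simp only [coeff_sub]
  exact (hP j).sub (hQ j)

lemma mul (hP : HasCoeffDerivAt P P' c) (hQ : HasCoeffDerivAt Q Q' c) :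
    HasCoeffDerivAt (fun t => P t * Q t) (P' * Q c + P c * Q') c := fun j => by
  simp only [coeff_mul, coeff_add, ← Finset.sum_add_distrib]
  exact HasDerivAt.fun_sum fun i _ => (hP i.1).mul (hQ i.2)

/-- Product rule for a moving functional on a moving polynomial. The degree bound uniform in t
reduces it to a finite sum over moments. -/
lemma map {L : ℝ → ℝ[X] →ₗ[ℝ] ℝ} {N : ℕ}
    (hL : ∀ q, HasDerivAt (fun t => L t q) (L c (X * q) / c) c)
    (hP : HasCoeffDerivAt P P' c) (hN : ∀ t, (P t).natDegree ≤ N) :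
    HasDerivAt (fun t => L t (P t)) (L c (X * P c) / c + L c P') c := by
  have hN' : P'.natDegree ≤ N := by
    rw [natDegree_le_iff_coeff_eq_zero]
    intro k hk
    have h := hP k
    have h0 : (fun t => (P t).coeff k) = fun _ => 0 :=
      funext fun t => coeff_eq_zero_of_natDegree_lt ((hN t).trans_lt hk)
    rw [h0] at h
    exact h.unique (hasDerivAt_const _ _)
  have expand : ∀ (M : ℝ[X] →ₗ[ℝ] ℝ) (p : ℝ[X]), p.natDegree ≤ N →
      M p = ∑ i ∈ Finset.range (N + 1), p.coeff i * M (X ^ i) := by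
    intro M p hp
    conv_lhs => rw [p.as_sum_range_C_mul_X_pow' (Nat.lt_succ_of_le hp)]
    rw [map_sum]
    exact Finset.sum_congr rfl fun i _ => MomentFunctional.map_C_mul M _ _
  have h1 : (fun t => L t (P t)) =
      fun t => ∑ i ∈ Finset.range (N + 1), (P t).coeff i * L t (X ^ i) :=
    funext fun t => expand _ _ (hN t)
  have h2 : L c (X * P c) = ∑ i ∈ Finset.range (N + 1), (P c).coeff i * L c (X * X ^ i) :=
    expand ((L c).comp (LinearMap.mulLeft ℝ X)) _ (hN c)
  rw [h1, h2, expand _ _ hN', Finset.sum_div, ← Finset.sum_add_distrib]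
  refine HasDerivAt.fun_sum fun i _ => ?_
  refine ((hP i).mul (hL (X ^ i))).congr_deriv ?_
  ring

end HasCoeffDerivAt

namespace MomentFunctional

variable {L : ℝ → ℝ[X] →ₗ[ℝ] ℝ} {c : ℝ}

/-- The derivative of P_n is a multiple of P_{n-1}, hence orthogonal to P_n; only the derivative of
the functional contributes. -/
lemma hasDerivAt_normSq_of_poly (hL : ∀ p : ℝ[X], p ≠ 0 → 0 < L c (p * p))
    (hD : ∀ q, HasDerivAt (fun t => L t q) (L c (X * q) / c) c) {n : ℕ}
    (hn : HasCoeffDerivAt (fun t => poly (L t) n) (C (-(recA (L c) n / c)) * prev (L c) n) c) :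
    HasDerivAt (fun t => normSq (L t) n) (recB (L c) n * normSq (L c) n / c) c := by
  have h := (hn.mul hn).map (N := n + n) hD fun t =>
    natDegree_mul_le_of_le (natDegree_poly _ n).le (natDegree_poly _ n).le
  refine h.congr_deriv ?_
  rw [recB_mul hL, map_add, mul_assoc, map_C_mul, mul_comm (prev (L c) n), mul_left_comm,
    map_C_mul, map_poly_mul_prev hL]
  ring

lemma hasDerivAt_recB_of_poly (hL : ∀ p : ℝ[X], p ≠ 0 → 0 < L c (p * p))
    (hD : ∀ q, HasDerivAt (fun t => L t q) (L c (X * q) / c) c) {n : ℕ}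
    (hn : HasCoeffDerivAt (fun t => poly (L t) n) (C (-(recA (L c) n / c)) * prev (L c) n) c) :
    HasDerivAt (fun t => recB (L t) n) ((recA (L c) (n + 1) - recA (L c) n) / c) c := by
  have hpos := (normSq_pos hL n).ne'
  have h := ((HasCoeffDerivAt.const X c).mul (hn.mul hn)).map (N := 1 + (n + n)) hD fun t =>
    natDegree_mul_le_of_le natDegree_X_le
      (natDegree_mul_le_of_le (natDegree_poly _ n).le (natDegree_poly _ n).le)
  have h2 := h.div (hasDerivAt_normSq_of_poly hL hD hn) hpos
  refine h2.congr_deriv ?_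
  rw [recB_mul hL]
  have e1 : X * (X * (poly (L c) n * poly (L c) n)) =
    poly (L c) n * (X ^ 2 * poly (L c) n) := by ring
  have e2 : 0 * (poly (L c) n * poly (L c) n) +
      X * (C (-(recA (L c) n / c)) * prev (L c) n * poly (L c) n
        + poly (L c) n * (C (-(recA (L c) n / c)) * prev (L c) n)) =
      C (-2 * (recA (L c) n / c)) * (prev (L c) n * (X * poly (L c) n)) := by
    have : (C (-2 * (recA (L c) n / c)) : ℝ[X]) = 2 * C (-(recA (L c) n / c)) := by
      rw [show -2 * (recA (L c) n / c) = 2 * (-(recA (L c) n / c)) by ring, C_mul]; rfl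
    rw [this]; ring
  have h1 : L c (prev (L c) n * poly (L c) (n + 1)) = 0 := by
    rw [mul_comm]
    exact map_poly_mul_of_degree_lt hL _ _
      ((degree_prev_lt (L c) n).trans (by exact_mod_cast n.lt_succ_self))
  rw [e1, e2, map_C_mul, map_X_sq_mul_poly_sq hL, map_mul_X_poly, h1,
    mul_comm (prev (L c) n) (poly (L c) n), map_poly_mul_prev hL]
  have h3 := recA_mul_map_prev hL n
  have h4 : recA (L c) n / c * (recA (L c) n * L c (prev (L c) n * prev (L c) n)) =
      recA (L c) n * normSq (L c) n / c := by rw [← h3]; ring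
  have h5 : -2 * (recA (L c) n / c) * (0 + recB (L c) n * 0 +
      recA (L c) n * L c (prev (L c) n * prev (L c) n)) =
      -2 * (recA (L c) n * normSq (L c) n / c) := by rw [← h4]; ring
  rw [h5]
  field_simp
  ring

/-- The three-term recurrence needs two predecessors, so the induction carries consecutive indices.
The derivatives of b_n and h_n require that of P_n only, which avoids circularity. -/
lemma hasDerivAt_poly (hL : ∀ p : ℝ[X], p ≠ 0 → 0 < L c (p * p))
    (hD : ∀ q, HasDerivAt (fun t => L t q) (L c (X * q) / c) c) (n : ℕ) :
    HasCoeffDerivAt (fun t => poly (L t) n) (C (-(recA (L c) n / c)) * prev (L c) n) c ∧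
    HasCoeffDerivAt (fun t => poly (L t) (n + 1))
      (C (-(recA (L c) (n + 1) / c)) * prev (L c) (n + 1)) c := by
  induction n with
  | zero =>
    have h0 : HasCoeffDerivAt (fun t => poly (L t) 0)
        (C (-(recA (L c) 0 / c)) * prev (L c) 0) c := by
      simpa using HasCoeffDerivAt.const 1 c
    refine ⟨h0, ?_⟩
    have hb := hasDerivAt_recB_of_poly hL hD h0
    have h := (HasCoeffDerivAt.const X c).sub (HasCoeffDerivAt.C_of_hasDerivAt hb)
    convert h using 1
    · ext1 t; simp [poly_succ]
    · simp
  | succ n ih =>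
    obtain ⟨h0, h1⟩ := ih
    refine ⟨h1, ?_⟩
    have hb := hasDerivAt_recB_of_poly hL hD h1
    have ha := (hasDerivAt_normSq_of_poly hL hD h1).div (hasDerivAt_normSq_of_poly hL hD h0)
      (normSq_pos hL n).ne'
    have h := (((HasCoeffDerivAt.const X c).sub (HasCoeffDerivAt.C_of_hasDerivAt hb)).mul h1).sub
      ((HasCoeffDerivAt.C_of_hasDerivAt ha).mul h0)
    have e : (recB (L c) (n + 1) * normSq (L c) (n + 1) / c * normSq (L c) n -
        normSq (L c) (n + 1) * (recB (L c) n * normSq (L c) n / c)) / normSq (L c) n ^ 2 =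
        recA (L c) (n + 1) / c * (recB (L c) (n + 1) - recB (L c) n) := by
      have := (normSq_pos hL n).ne'
      rw [recA_succ]
      field_simp
    have e' : normSq (L c) (n + 1) / normSq (L c) n = recA (L c) (n + 1) := rfl
    simp only [Pi.div_apply, e, e'] at h
    change HasCoeffDerivAt (fun t => poly (L t) (n + 1 + 1)) _ c at h
    convert h using 1
    rw [prev_succ, prev_succ, poly_succ (L c) n]
    have e3 : (recA (L c) (n + 1 + 1) - recA (L c) (n + 1)) / c =
      recA (L c) (n + 1 + 1) / c - recA (L c) (n + 1) / c := by ring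
    have e4 : (C (recA (L c) n / c) : ℝ[X]) * C (recA (L c) (n + 1)) =
        C (recA (L c) (n + 1) / c) * C (recA (L c) n) := by
      rw [← C_mul, ← C_mul]; congr 1; ring
    rw [e3]
    simp only [C_neg, C_mul, C_sub]
    linear_combination -prev (L c) n * e4

/-- The Toda equation for `b_n`. -/
lemma hasDerivAt_recB (hL : ∀ p : ℝ[X], p ≠ 0 → 0 < L c (p * p))
    (hD : ∀ q, HasDerivAt (fun t => L t q) (L c (X * q) / c) c) (n : ℕ) :
    HasDerivAt (fun t => recB (L t) n) ((recA (L c) (n + 1) - recA (L c) n) / c) c :=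
  hasDerivAt_recB_of_poly hL hD (hasDerivAt_poly hL hD n).1

/-- The Toda equation for `a_n ^ 2`. -/
lemma hasDerivAt_recA (hL : ∀ p : ℝ[X], p ≠ 0 → 0 < L c (p * p))
    (hD : ∀ q, HasDerivAt (fun t => L t q) (L c (X * q) / c) c) (n : ℕ) :
    HasDerivAt (fun t => recA (L t) n)
      (recA (L c) n * (recB (L c) n - prevB (L c) n) / c) c := by
  cases n with
  | zero => simpa using hasDerivAt_const c (0 : ℝ)
  | succ n =>
    have := (normSq_pos hL n).ne'
    have ha := (hasDerivAt_normSq_of_poly hL hD (hasDerivAt_poly hL hD n).2).div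
      (hasDerivAt_normSq_of_poly hL hD (hasDerivAt_poly hL hD n).1) this
    refine ha.congr_deriv ?_
    rw [recA_succ, prevB_succ]
    field_simp

lemma hasDerivAt_sumB (hL : ∀ p : ℝ[X], p ≠ 0 → 0 < L c (p * p))
    (hD : ∀ q, HasDerivAt (fun t => L t q) (L c (X * q) / c) c) (n : ℕ) :
    HasDerivAt (fun t => sumB (L t) n) (recA (L c) n / c) c := by
  induction n with
  | zero => simpa using hasDerivAt_const c (0 : ℝ)
  | succ n ih =>
    simp only [sumB_succ]
    refine (ih.add (hasDerivAt_recB hL hD n)).congr_deriv ?_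
    ring

end MomentFunctional

/-! ### The Lax determinant -/

namespace MomentFunctional

/-- The properties of the moment functionals of the hypergeometric weights that determine how their
recurrence coefficients depend on `n` and `c`: positivity, the derivative in `c`, and the Pearson
equation. -/
structure IsHypergeometricFamily (α β γ : ℝ) (L : ℝ → ℝ[X] →ₗ[ℝ] ℝ) : Prop where
  pos : ∀ c ∈ Set.Ioo (0 : ℝ) 1, ∀ p : ℝ[X], p ≠ 0 → 0 < L c (p * p)
  hasDerivAt : ∀ c ∈ Set.Ioo (0 : ℝ) 1, ∀ q, HasDerivAt (fun t => L t q) (L c (X * q) / c) c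
  pearson : ∀ c ∈ Set.Ioo (0 : ℝ) 1, ∀ f : ℝ[X],
    L c (X * (X + C (γ - 1)) * f.comp (X + C (-1))) = c * L c ((X + C α) * (X + C β) * f)

variable {α β γ c : ℝ} {L : ℝ → ℝ[X] →ₗ[ℝ] ℝ}

/-- The derivative in `c` of the Laguerre–Freud relation, simplified by the Toda equations. -/
lemma IsHypergeometricFamily.deriv_laguerre_freud (h : IsHypergeometricFamily α β γ L)
    (hc : c ∈ Set.Ioo (0 : ℝ) 1) (n : ℕ) :
    (1 - c) * (recA (L c) (n + 1) * (recB (L c) (n + 1) - recB (L c) n)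
        + recA (L c) n * (recB (L c) n - prevB (L c) n)
        + 2 * recB (L c) n * (recA (L c) (n + 1) - recA (L c) n))
      - c * (recA (L c) (n + 1) + recA (L c) n + recB (L c) n ^ 2)
      + (γ - 1 - n) * (recA (L c) (n + 1) - recA (L c) n) - recA (L c) n =
    c * ((α + β + n) * recB (L c) n + α * β + n * (α + β) + n * (n - 1) / 2 + sumB (L c) n)
      + c * ((α + β + n) * (recA (L c) (n + 1) - recA (L c) n) + recA (L c) n) := by
  have hc0 : c ≠ 0 := hc.1.ne'
  have ha := hasDerivAt_recA (h.pos c hc) (h.hasDerivAt c hc) n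
  have ha' := hasDerivAt_recA (h.pos c hc) (h.hasDerivAt c hc) (n + 1)
  have hb := hasDerivAt_recB (h.pos c hc) (h.hasDerivAt c hc) n
  have hB := hasDerivAt_sumB (h.pos c hc) (h.hasDerivAt c hc) n
  have hid := hasDerivAt_id' c
  have hl := ((((hid.const_sub 1).mul ((ha'.add ha).add (hb.pow 2))).add
    (hb.const_mul (γ - 1 - n))).sub hB)
  have hr := hid.mul (((hb.const_mul (α + β + n)).add hB).add_const
    (α * β + n * (α + β) + n * (n - 1) / 2))
  have hz := (hl.sub hr)
  -- The relation holds on the whole interval, so it can be differentiated; the terms free of c are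
  -- gathered on one side as a constant.
  have hev := Filter.eventuallyEq_of_mem (isOpen_Ioo.mem_nhds hc) fun t ht =>
    show n * (γ - 1) - n * (n - 1) / 2 =
      (1 - t) * (recA (L t) (n + 1) + recA (L t) n + recB (L t) n ^ 2)
        + (γ - 1 - n) * recB (L t) n - sumB (L t) n
        - t * ((α + β + n) * recB (L t) n + sumB (L t) n
            + (α * β + n * (α + β) + n * (n - 1) / 2)) by
      linear_combination -laguerre_freud (h.pos t ht) (h.pearson t ht) n
  have hu := (hz.congr_of_eventuallyEq hev).unique (hasDerivAt_const _ _)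
  simp only [Pi.add_apply, Pi.pow_apply, prevB_succ] at hu
  field_simp at hu
  push_cast at hu
  linear_combination hu / 2

/-- The constant coefficient of the upper diagonal entry of the Lax matrix. -/
noncomputable def laxU (γ c : ℝ) (M : ℝ[X] →ₗ[ℝ] ℝ) (n : ℕ) : ℝ :=
  (1 - c) * recA M n + n * (n - 1) / 2 - n * (γ - 1) - sumB M n

/-- The constant coefficient of the lower diagonal entry of the Lax matrix. -/
noncomputable def laxV (α β c : ℝ) (M : ℝ[X] →ₗ[ℝ] ℝ) (n : ℕ) : ℝ :=
  c * (α * β + (n - 1) * (α + β) + (n - 1) * (n - 2) / 2 + sumB M n) - (1 - c) * recA M n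

/-- The constant coefficient of the off-diagonal entry of the Lax matrix that belongs to the
index `n`, where `b = b_n`. -/
noncomputable def laxOff (α β γ c n b : ℝ) : ℝ :=
  (1 - c) * b + γ - 1 - n - c * (α + β + n - 1)

/-- The determinant of the Lax matrix is `c x (x + γ - 1) (x + α - 1) (x + β - 1)`: the
coefficients of `x ^ 0` and `x ^ 1`. -/
lemma IsHypergeometricFamily.lax_det (h : IsHypergeometricFamily α β γ L)
    (hc : c ∈ Set.Ioo (0 : ℝ) 1) (n : ℕ) :
    laxU γ c (L c) n * laxV α β c (L c) n + recA (L c) n * laxOff α β γ c n (recB (L c) n)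
        * laxOff α β γ c (n - 1) (prevB (L c) n) = 0 ∧
    (γ - 1 - n) * laxV α β c (L c) n + c * (α + β + n - 2) * laxU γ c (L c) n
        + (1 - c) * recA (L c) n * (laxOff α β γ c n (recB (L c) n)
          + laxOff α β γ c (n - 1) (prevB (L c) n)) =
      c * (γ - 1) * (α - 1) * (β - 1) := by
  -- The coefficients of x², x³ and x⁴ agree by the definitions alone. For n = 0, a_0 and U vanish.
  induction n with
  | zero =>
    constructor
    · simp [laxU]
    · simp [laxU, laxV]; ring
  | succ n ih =>
    obtain ⟨h0, h1⟩ := ih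
    have hI := laguerre_freud (h.pos c hc) (h.pearson c hc) n
    have hII := h.deriv_laguerre_freud hc n
    -- The next three identities describe the passage from n to n + 1. The first two restate the
    -- Laguerre–Freud relation; the third needs its derivative as well.
    have hV : laxV α β c (L c) (n + 1) =
        laxU γ c (L c) n + recB (L c) n * laxOff α β γ c n (recB (L c) n) := by
      simp only [laxU, laxV, laxOff, sumB_succ]
      push_cast
      linear_combination -hI
    have hU : laxU γ c (L c) (n + 1) =
        laxV α β c (L c) n - (1 + recB (L c) n) * laxOff α β γ c n (recB (L c) n) := by
      simp only [laxU, laxV, laxOff, sumB_succ]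
      push_cast
      linear_combination hI
    have hoff : recA (L c) (n + 1) * laxOff α β γ c (n + 1 : ℕ) (recB (L c) (n + 1)) =
        -recB (L c) n * laxU γ c (L c) (n + 1) + (1 + recB (L c) n) * laxU γ c (L c) n
          + recA (L c) n * laxOff α β γ c (n - 1) (prevB (L c) n) := by
      simp only [laxU, laxOff, sumB_succ]
      push_cast
      linear_combination hII - hI
    have hA : (1 - c) * recA (L c) (n + 1) = laxU γ c (L c) (n + 1) - laxU γ c (L c) n
        + (1 - c) * recA (L c) n - n + (γ - 1) + recB (L c) n := by
      simp only [laxU, sumB_succ]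
      push_cast
      ring
    have hcast : ((n + 1 : ℕ) : ℝ) - 1 = n := by push_cast; ring
    rw [hcast, prevB_succ]
    constructor
    · rw [hoff, hV]
      rw [hU]
      linear_combination h0
    · have e : (1 - c) * recA (L c) (n + 1) * (laxOff α β γ c (n + 1 : ℕ) (recB (L c) (n + 1))
          + laxOff α β γ c n (recB (L c) n)) =
          (1 - c) * (recA (L c) (n + 1) * laxOff α β γ c (n + 1 : ℕ) (recB (L c) (n + 1)))
          + (1 - c) * recA (L c) (n + 1) * laxOff α β γ c n (recB (L c) n) := by ring
      rw [e, hoff, hA, hV, hU]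
      push_cast
      have hl : laxOff α β γ c n (recB (L c) n) =
        (1 - c) * recB (L c) n + γ - 1 - n - c * (α + β + n - 1) := rfl
      set l := laxOff α β γ c n (recB (L c) n)
      set l' := laxOff α β γ c (n - 1) (prevB (L c) n)
      linear_combination h1 +
        (laxV α β c (L c) n - laxU γ c (L c) n - (1 + recB (L c) n) * l) * hl
end MomentFunctional

/-! ### The σ-form of Painlevé VI -/

namespace MomentFunctional

variable {α β γ c : ℝ} {L : ℝ → ℝ[X] →ₗ[ℝ] ℝ}

/-- The constant term of the affine function that is added to `(c - 1) ∑ b_j` in `σ_n`. -/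
noncomputable def sigmaShift (α β γ n : ℝ) : ℝ :=
  1 / 4 * ((α + β + γ + 1) * n + α ^ 2 + β ^ 2 - (α + β) * (γ + 1) + 2 * γ) - n * γ
    + n * (n - 1) / 2

/-- The slope of the affine function that is added to `(c - 1) ∑ b_j` in `σ_n`. -/
noncomputable def sigmaSlope (α β n : ℝ) : ℝ :=
  α * β - 1 / 4 * (α + β + n) ^ 2 + n * (α + β) + n * (n - 1) / 2

lemma IsHypergeometricFamily.hasDerivAt_sigma (h : IsHypergeometricFamily α β γ L)
    (hc : c ∈ Set.Ioo (0 : ℝ) 1) (n : ℕ) (ν μ : ℝ) :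
    HasDerivAt (fun t => (t - 1) * sumB (L t) n + ν * t + μ)
      (sumB (L c) n + (c - 1) * recA (L c) n / c + ν) c := by
  have hB := hasDerivAt_sumB (h.pos c hc) (h.hasDerivAt c hc) n
  have hid := hasDerivAt_id' c
  refine ((((hid.sub_const 1).mul hB).add (hid.const_mul ν)).add_const μ).congr_deriv ?_
  ring

lemma IsHypergeometricFamily.hasDerivAt_deriv_sigma (h : IsHypergeometricFamily α β γ L)
    (hc : c ∈ Set.Ioo (0 : ℝ) 1) (n : ℕ) (ν : ℝ) :
    HasDerivAt (fun t => sumB (L t) n + (t - 1) * recA (L t) n / t + ν)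
      (((1 + c) * recA (L c) n
        - (1 - c) * (recA (L c) n * (recB (L c) n - prevB (L c) n))) / c ^ 2) c := by
  have hB := hasDerivAt_sumB (h.pos c hc) (h.hasDerivAt c hc) n
  have ha := hasDerivAt_recA (h.pos c hc) (h.hasDerivAt c hc) n
  have hid := hasDerivAt_id' c
  have hc0 : c ≠ 0 := hc.1.ne'
  refine ((hB.add (((hid.sub_const 1).mul ha).div hid hc0)).add_const ν).congr_deriv ?_
  simp only [Pi.mul_apply]
  field_simp
  ring

lemma IsHypergeometricFamily.continuousAt_second_deriv (h : IsHypergeometricFamily α β γ L)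
    (hc : c ∈ Set.Ioo (0 : ℝ) 1) (n : ℕ) :
    ContinuousAt (fun t => ((1 + t) * recA (L t) n
        - (1 - t) * (recA (L t) n * (recB (L t) n - prevB (L t) n))) / t ^ 2) c := by
  have ha := (hasDerivAt_recA (h.pos c hc) (h.hasDerivAt c hc) n).continuousAt
  have hb := (hasDerivAt_recB (h.pos c hc) (h.hasDerivAt c hc) n).continuousAt
  have hb' : ContinuousAt (fun t => prevB (L t) n) c := by
    cases n with
    | zero => simpa [prevB] using continuousAt_const
    | succ n => exact (hasDerivAt_recB (h.pos c hc) (h.hasDerivAt c hc) n).continuousAt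
  have hc0 : c ^ 2 ≠ 0 := pow_ne_zero _ hc.1.ne'
  fun_prop (disch := assumption)

/-- If the sum `b_0 + ⋯ + b_{n-1}` is completed by a suitable affine function of `c`, it solves the
`σ`-form of the sixth Painlevé equation. -/
lemma IsHypergeometricFamily.isSigmaPVISolutionOn (h : IsHypergeometricFamily α β γ L) (n : ℕ)
    {σ : ℝ → ℝ} (hσ : ∀ t ∈ Set.Ioo (0 : ℝ) 1,
      σ t = (t - 1) * sumB (L t) n + sigmaSlope α β n * t + sigmaShift α β γ n) :
    IsSigmaPVISolutionOn
      (((n : ℝ) + α - β) / 2) ((-(n : ℝ) + α - β) / 2)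
      (((n : ℝ) + α + β - 2) / 2) (((n : ℝ) + α + β - 2 * γ) / 2) σ (Set.Ioo (0 : ℝ) 1) := by
  have hd1 : ∀ t ∈ Set.Ioo (0 : ℝ) 1, HasDerivAt σ
      (sumB (L t) n + (t - 1) * recA (L t) n / t + sigmaSlope α β n) t := fun t ht =>
    (h.hasDerivAt_sigma ht n _ _).congr_of_eventuallyEq
      (Filter.eventuallyEq_of_mem (isOpen_Ioo.mem_nhds ht) hσ)
  have hd2 : ∀ t ∈ Set.Ioo (0 : ℝ) 1, HasDerivAt (deriv σ) (((1 + t) * recA (L t) n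
        - (1 - t) * (recA (L t) n * (recB (L t) n - prevB (L t) n))) / t ^ 2) t := fun t ht =>
    (h.hasDerivAt_deriv_sigma ht n _).congr_of_eventuallyEq
      (Filter.eventuallyEq_of_mem (isOpen_Ioo.mem_nhds ht) fun s hs => (hd1 s hs).deriv)
  constructor
  · have hC : ContDiffOn ℝ (1 + 1) σ (Set.Ioo 0 1) := by
      rw [contDiffOn_succ_iff_deriv_of_isOpen isOpen_Ioo]
      refine ⟨fun t ht => (hd1 t ht).differentiableAt.differentiableWithinAt, by simp, ?_⟩
      rw [show (1 : WithTop ℕ∞) = 0 + 1 by simp, contDiffOn_succ_iff_deriv_of_isOpen isOpen_Ioo]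
      refine ⟨fun t ht => (hd2 t ht).differentiableAt.differentiableWithinAt, by simp, ?_⟩
      rw [contDiffOn_zero]
      refine ContinuousOn.congr (fun t ht =>
        (h.continuousAt_second_deriv ht n).continuousWithinAt) fun t ht => (hd2 t ht).deriv
    simpa [one_add_one_eq_two] using hC
  · intro c hc
    have hc0 : c ≠ 0 := hc.1.ne'
    obtain ⟨h0, h1⟩ := h.lax_det hc n
    have hs := hσ c hc
    have hs1 := (hd1 c hc).deriv
    have hs2 := (hd2 c hc).deriv
    set s := σ c
    set s1 := deriv σ c
    set s2 := deriv (deriv σ) c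
    set a := recA (L c) n
    set U := laxU γ c (L c) n with hU
    set V := laxV α β c (L c) n with hV
    set l := laxOff α β γ c n (recB (L c) n) with hl
    set l' := laxOff α β γ c (n - 1) (prevB (L c) n) with hl'
    -- Dictionary between the Lax data and σ, σ', σ''.
    have kV : V = c * (s1 + (((n : ℝ) + α + β - 2) / 2) ^ 2) := by
      rw [hs1, hV, laxV, sigmaSlope]; field_simp; ring
    have kU : U = s - c * s1 + n * (n - 1) / 2 - n * (γ - 1) - sigmaShift α β γ n := by
      rw [hs1, hs, hU, laxU]; field_simp; ring
    have kA : (1 - c) ^ 2 * a =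
        c * (sigmaSlope α β n + sigmaShift α β γ n - s + (c - 1) * s1) := by
      rw [hs1, hs]; field_simp; ring
    have kS : c ^ 2 * s2 = -(a * (l - l')) := by
      rw [hs2, hl, hl', laxOff, laxOff]; field_simp; ring
    -- This is (l - l')² = (l + l')² - 4 l l' times (1-c)² a², with l + l' and l l' eliminated by
    -- the determinant.
    have kF : 4 * ((1 - c) ^ 2 * a) * U * V + (c * (γ - 1) * (α - 1) * (β - 1)
        - (γ - 1 - n) * V - c * (α + β + n - 2) * U) ^ 2 = (1 - c) ^ 2 * (c ^ 2 * s2) ^ 2 := by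
      have e : c * (γ - 1) * (α - 1) * (β - 1) - (γ - 1 - n) * V - c * (α + β + n - 2) * U =
        (1 - c) * a * (l + l') := by linear_combination -h1
      rw [e, kS]
      linear_combination 4 * (1 - c) ^ 2 * a * h0
    have kG : 4 * (sigmaSlope α β n + sigmaShift α β γ n - s + (c - 1) * s1) * U
          * (s1 + (((n : ℝ) + α + β - 2) / 2) ^ 2)
        + ((γ - 1) * (α - 1) * (β - 1)
          - (γ - 1 - n) * (s1 + (((n : ℝ) + α + β - 2) / 2) ^ 2) - (α + β + n - 2) * U) ^ 2 =
        (c * (c - 1) * s2) ^ 2 := by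
      rw [kA, kV] at kF
      refine mul_left_cancel₀ (pow_ne_zero 2 hc0) ?_
      linear_combination kF
    -- The second derivative occurs only through the square given by `kG`; what remains is a
    -- polynomial identity in σ, σ' and c.
    rw [← kG, kU, sigmaSlope, sigmaShift]
    ring

end MomentFunctional

/-! ### The hypergeometric weight and its functional -/

section HypergeometricWeight

variable {α β γ c : ℝ}

lemma hypWeight_eq_mul_pow (α β γ c : ℝ) (k : ℕ) :
    hypWeight α β γ c k = hypWeight α β γ 1 k * c ^ k := by
  simp [hypWeight]

lemma hypWeight_pos (hα : 0 < α) (hβ : 0 < β) (hγ : 0 < γ) (hc : 0 < c) (k : ℕ) :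
    0 < hypWeight α β γ c k := by
  have h1 := ascPochhammer_pos k α hα
  have h2 := ascPochhammer_pos k β hβ
  have h3 := ascPochhammer_pos k γ hγ
  have h4 : (0 : ℝ) < k.factorial := by exact_mod_cast k.factorial_pos
  unfold hypWeight
  positivity

lemma hypWeight_succ (hγ : 0 < γ) (k : ℕ) :
    (k + 1) * (k + γ) * hypWeight α β γ c (k + 1) =
      c * ((k + α) * (k + β)) * hypWeight α β γ c k := by
  have h3 := (ascPochhammer_pos k γ hγ).ne'
  have h4 : (k.factorial : ℝ) ≠ 0 := by exact_mod_cast k.factorial_ne_zero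
  have h5 : γ + k ≠ 0 := by positivity
  have h6 : (k + 1 : ℝ) ≠ 0 := by positivity
  simp only [hypWeight, ascPochhammer_succ_eval, Nat.factorial_succ]
  push_cast
  field_simp
  ring

lemma summable_pow_mul_hypWeight (hα : 0 < α) (hβ : 0 < β) (hγ : 0 < γ)
    (hc : c ∈ Set.Ioo (0 : ℝ) 1) (i : ℕ) :
    Summable fun k : ℕ => (k : ℝ) ^ i * hypWeight α β γ c k := by
  have hw := hypWeight_pos hα hβ hγ hc.1
  -- Unlike k^i, the majorant (k+1)^i is nonzero at k = 0, so every ratio makes sense.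
  have hs : Summable fun k : ℕ => ((k : ℝ) + 1) ^ i * hypWeight α β γ c k := by
    refine summable_of_ratio_test_tendsto_lt_one hc.2
      (Eventually.of_forall fun k => (mul_pos (by positivity) (hw k)).ne') ?_
    have ht : ∀ x y : ℝ, Tendsto (fun k : ℕ => (x + 1 * (k : ℝ)) / (y + 1 * k)) atTop (𝓝 1) :=
      fun x y => by simpa using tendsto_add_mul_div_add_mul_atTop_nhds x y 1 one_ne_zero
    have hlim := ((((ht 2 1).pow i).mul (ht α 1)).mul (ht β γ)).mul_const c
    simp only [one_pow, one_mul] at hlim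
    refine hlim.congr fun k => ?_
    have hk := hw k
    have hk1 := hw (k + 1)
    have hrec := hypWeight_succ (α := α) (β := β) (c := c) hγ k
    have e : hypWeight α β γ c (k + 1) =
        c * ((k + α) * (k + β)) * hypWeight α β γ c k / ((k + 1) * (k + γ)) := by
      rw [← hrec]; field_simp
    rw [Real.norm_of_nonneg (by positivity), Real.norm_of_nonneg (by positivity), e]
    push_cast
    rw [div_pow]
    have h5 : γ + k ≠ 0 := by positivity
    have h5' : (k : ℝ) + γ ≠ 0 := by positivity
    have h6 : (1 + k : ℝ) ≠ 0 := by positivity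
    have h7 : (k + 1 : ℝ) ^ i ≠ 0 := by positivity
    rw [show (2 + k : ℝ) = k + 1 + 1 by ring, show (1 + k : ℝ) = k + 1 by ring,
      show γ + k = k + γ by ring]
    field_simp
    ring
  refine Summable.of_nonneg_of_le (fun k => ?_) (fun k => ?_) hs
  · have := hw k; positivity
  · have := (hw k).le
    gcongr
    linarith

/-- The moments of the hypergeometric weight. -/
noncomputable def hypMoment (α β γ c : ℝ) (i : ℕ) : ℝ :=
  ∑' k : ℕ, (k : ℝ) ^ i * hypWeight α β γ c k

/-- Summation of a polynomial against the hypergeometric weight. -/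
noncomputable def hypFunctional (α β γ c : ℝ) : ℝ[X] →ₗ[ℝ] ℝ :=
  lsum fun i => hypMoment α β γ c i • LinearMap.id

lemma hypFunctional_apply (q : ℝ[X]) : hypFunctional α β γ c q =
    ∑ i ∈ q.support, hypMoment α β γ c i * q.coeff i := by
  simp [hypFunctional, Polynomial.sum]

lemma hasSum_hypFunctional (hα : 0 < α) (hβ : 0 < β) (hγ : 0 < γ)
    (hc : c ∈ Set.Ioo (0 : ℝ) 1) (q : ℝ[X]) :
    HasSum (fun k : ℕ => q.eval (k : ℝ) * hypWeight α β γ c k) (hypFunctional α β γ c q) := by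
  rw [hypFunctional_apply]
  have h := hasSum_sum (s := q.support) fun i _ =>
    ((summable_pow_mul_hypWeight hα hβ hγ hc i).hasSum.mul_right (q.coeff i))
  refine h.congr_fun fun k => ?_
  rw [eval_eq_sum, Polynomial.sum, Finset.sum_mul]
  exact Finset.sum_congr rfl fun i _ => by ring

lemma hasDerivAt_hypMoment (hα : 0 < α) (hβ : 0 < β) (hγ : 0 < γ)
    (hc : c ∈ Set.Ioo (0 : ℝ) 1) (i : ℕ) :
    HasDerivAt (fun t => hypMoment α β γ t i) (hypMoment α β γ c (i + 1) / c) c := by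
  -- On (0, r) the termwise derivatives are dominated by their values at r < 1, which are summable.
  obtain ⟨r, hcr, hr1⟩ := exists_between hc.2
  have hr0 : 0 < r := hc.1.trans hcr
  have hv := hypWeight_pos hα hβ hγ one_pos
  have hd := hasDerivAt_tsum_of_isPreconnected (t := Set.Ioo 0 r)
    (g := fun (k : ℕ) (t : ℝ) => (k : ℝ) ^ i * hypWeight α β γ t k)
    (g' := fun (k : ℕ) (t : ℝ) => (k : ℝ) ^ i * (hypWeight α β γ 1 k * (k * t ^ (k - 1))))
    (u := fun k : ℕ => (k : ℝ) ^ (i + 1) * hypWeight α β γ r k / r)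
    ((summable_pow_mul_hypWeight hα hβ hγ ⟨hr0, hr1⟩ (i + 1)).div_const r) isOpen_Ioo
    isPreconnected_Ioo (fun k t _ => ?_) (fun k t ht => ?_) ⟨hc.1, hcr⟩
    (summable_pow_mul_hypWeight hα hβ hγ hc i) ⟨hc.1, hcr⟩
  · refine hd.congr_deriv ?_
    rw [hypMoment, ← tsum_div_const]
    refine tsum_congr fun k => ?_
    have hc0 := hc.1.ne'
    rw [hypWeight_eq_mul_pow α β γ c]
    cases k with
    | zero => simp
    | succ k => rw [Nat.add_sub_cancel]; field_simp; ring
  · rw [show (fun t : ℝ => (k : ℝ) ^ i * hypWeight α β γ t k) =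
      fun t => (k : ℝ) ^ i * (hypWeight α β γ 1 k * t ^ k) from
        funext fun t => by rw [hypWeight_eq_mul_pow α β γ t]]
    exact ((hasDerivAt_pow k t).const_mul _).const_mul _
  · have hk := (hv k).le
    have ht0 := ht.1.le
    rw [Real.norm_of_nonneg (by positivity), hypWeight_eq_mul_pow α β γ r]
    have e : (k : ℝ) ^ (i + 1) * (hypWeight α β γ 1 k * r ^ k) / r =
        (k : ℝ) ^ i * (hypWeight α β γ 1 k * (k * r ^ (k - 1))) := by
      cases k with
      | zero => simp
      | succ k => rw [Nat.add_sub_cancel]; field_simp; ring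
    rw [e]
    have := ht.2.le
    gcongr

lemma hasDerivAt_hypFunctional (hα : 0 < α) (hβ : 0 < β) (hγ : 0 < γ)
    (hc : c ∈ Set.Ioo (0 : ℝ) 1) (q : ℝ[X]) :
    HasDerivAt (fun t => hypFunctional α β γ t q) (hypFunctional α β γ c (X * q) / c) c := by
  induction q using Polynomial.induction_on' with
  | add p q hp hq =>
    simp only [map_add, mul_add, add_div]
    exact hp.add hq
  | monomial n a =>
    have e : ∀ t m, hypFunctional α β γ t (monomial m a) = hypMoment α β γ t m * a := by
      intro t m; simp [hypFunctional, sum_monomial_index]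
    simp only [X_mul_monomial, e]
    refine ((hasDerivAt_hypMoment hα hβ hγ hc n).mul_const a).congr_deriv ?_
    ring

lemma hypFunctional_pos (hα : 0 < α) (hβ : 0 < β) (hγ : 0 < γ)
    (hc : c ∈ Set.Ioo (0 : ℝ) 1) (p : ℝ[X]) (hp : p ≠ 0) :
    0 < hypFunctional α β γ c (p * p) := by
  have hw := hypWeight_pos hα hβ hγ hc.1
  obtain ⟨k, hk⟩ : ∃ k : ℕ, p.eval (k : ℝ) ≠ 0 := by
    by_contra! H
    refine hp (eq_zero_of_infinite_isRoot p ?_)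
    exact (Set.infinite_range_of_injective Nat.cast_injective).mono
      (Set.range_subset_iff.2 H)
  refine hasSum_lt (f := fun _ : ℕ => (0 : ℝ)) (i := k) (fun j => ?_) ?_ hasSum_zero
    (hasSum_hypFunctional hα hβ hγ hc (p * p))
  · rw [eval_mul]
    exact mul_nonneg (mul_self_nonneg _) (hw j).le
  · rw [eval_mul]
    exact mul_pos (mul_self_pos.2 hk) (hw k)

lemma hypFunctional_pearson (hα : 0 < α) (hβ : 0 < β) (hγ : 0 < γ)
    (hc : c ∈ Set.Ioo (0 : ℝ) 1) (f : ℝ[X]) :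
    hypFunctional α β γ c (X * (X + C (γ - 1)) * f.comp (X + C (-1))) =
      c * hypFunctional α β γ c ((X + C α) * (X + C β) * f) := by
  -- The factor x kills the term k = 0; after the index shift the series agree term by term.
  have h1 := (hasSum_nat_add_iff' 1).2 (hasSum_hypFunctional hα hβ hγ hc
    (X * (X + C (γ - 1)) * f.comp (X + C (-1))))
  have h2 := (hasSum_hypFunctional hα hβ hγ hc ((X + C α) * (X + C β) * f)).mul_left c
  simp only [Finset.sum_range_one, eval_mul, eval_add, eval_X, eval_C, eval_comp, Nat.cast_zero,
    zero_mul, sub_zero] at h1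
  refine (h1.congr_fun fun k => ?_).unique h2
  have hrec := hypWeight_succ (α := α) (β := β) (c := c) hγ k
  simp only [eval_mul, eval_add, eval_X, eval_C]
  push_cast
  rw [show (k : ℝ) + 1 + -1 = k by ring]
  linear_combination (-f.eval (k : ℝ)) * hrec

lemma isHypergeometricFamily_hypFunctional (hα : 0 < α) (hβ : 0 < β) (hγ : 0 < γ) :
    MomentFunctional.IsHypergeometricFamily α β γ (hypFunctional α β γ) where
  pos _ hc := hypFunctional_pos hα hβ hγ hc
  hasDerivAt _ hc := hasDerivAt_hypFunctional hα hβ hγ hc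
  pearson _ hc := hypFunctional_pearson hα hβ hγ hc

end HypergeometricWeight

/-! ### Existence and uniqueness of the orthonormal polynomials -/

section OrthonormalSystem

variable {M : ℝ[X] →ₗ[ℝ] ℝ} {w : ℕ → ℝ}

lemma isOrthonormalSystem_iff
    (hM : ∀ q : ℝ[X], HasSum (fun k : ℕ => q.eval (k : ℝ) * w k) (M q)) {p : ℕ → ℝ[X]} :
    IsOrthonormalSystem w p ↔ (∀ n, (p n).natDegree = n) ∧ (∀ n, 0 < (p n).leadingCoeff) ∧
      ∀ n m, M (p n * p m) = if m = n then 1 else 0 := by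
  constructor
  · intro h
    refine ⟨h.natDegree_eq, h.leadingCoeff_pos, fun n m => ?_⟩
    refine (hM (p n * p m)).unique ((h.hasSum n m).congr_fun fun k => ?_)
    rw [eval_mul]
  · rintro ⟨h1, h2, h3⟩
    refine ⟨h1, h2, fun n m => ?_⟩
    rw [← h3]
    refine (hM (p n * p m)).congr_fun fun k => ?_
    rw [eval_mul]

lemma map_orthonormal_mul_eq_zero {p : ℕ → ℝ[X]} (hdeg : ∀ n, (p n).natDegree = n)
    (hlead : ∀ n, 0 < (p n).leadingCoeff) (horth : ∀ n m, M (p n * p m) = if m = n then 1 else 0)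
    (n : ℕ) : ∀ m ≤ n, ∀ q : ℝ[X], q.degree < (m : WithBot ℕ) → M (p n * q) = 0 := by
  intro m
  induction m with
  | zero =>
    intro _ q hq
    have : q = 0 := by
      rw [← degree_eq_bot]
      exact Nat.WithBot.lt_zero_iff.1 (by simpa using hq)
    simp [this]
  | succ m ih =>
    intro hm q hq
    set r := q.coeff m / (p m).leadingCoeff with hr
    have hlm : (p m).coeff m = (p m).leadingCoeff := by rw [leadingCoeff, hdeg]
    have key : (q - C r * p m).degree < (m : WithBot ℕ) := by
      rw [degree_lt_iff_coeff_zero] at hq ⊢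
      intro k hk
      rcases hk.lt_or_eq with h | h
      · rw [coeff_sub, coeff_C_mul, hq k (by omega),
          coeff_eq_zero_of_natDegree_lt (by rwa [hdeg])]; ring
      · subst h
        rw [coeff_sub, coeff_C_mul, hlm, hr, div_mul_cancel₀ _ (hlead m).ne', sub_self]
    have e : M (p n * q) = M (p n * (q - C r * p m)) + r * M (p n * p m) := by
      rw [← MomentFunctional.map_C_mul, ← map_add]; congr 1; ring
    rw [e, ih (by omega) _ key, horth, if_neg (by omega)]
    ring

/-- With κ the leading coefficient, r = p_n - κ P_n has degree below n, so it is orthogonal to both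
p_n and P_n, hence to itself, and positivity gives r = 0. -/
lemma eq_C_mul_poly_of_orthonormal (hpos : ∀ p : ℝ[X], p ≠ 0 → 0 < M (p * p)) {p : ℕ → ℝ[X]}
    (hdeg : ∀ n, (p n).natDegree = n) (hlead : ∀ n, 0 < (p n).leadingCoeff)
    (horth : ∀ n m, M (p n * p m) = if m = n then 1 else 0) (n : ℕ) :
    p n = C (1 / √(MomentFunctional.normSq M n)) * MomentFunctional.poly M n := by
  open MomentFunctional in
  set κ := (p n).leadingCoeff with hκ
  set r := p n - C κ * poly M n with hr
  have hlm : (p n).coeff n = κ := by rw [hκ, leadingCoeff, hdeg]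
  have hdr : r.degree < (n : WithBot ℕ) := by
    rw [degree_lt_iff_coeff_zero]
    intro k hk
    rcases hk.lt_or_eq with h | h
    · rw [hr, coeff_sub, coeff_C_mul, coeff_poly_of_lt M h,
        coeff_eq_zero_of_natDegree_lt (by rwa [hdeg])]; ring
    · subst h
      rw [hr, coeff_sub, coeff_C_mul, hlm, coeff_poly_self, mul_one, sub_self]
  have h0 : M (r * r) = 0 := by
    have e : r * r = p n * r - C κ * (poly M n * r) := by rw [hr]; ring
    rw [e, map_sub, map_C_mul, map_poly_mul_of_degree_lt hpos n r hdr,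
      map_orthonormal_mul_eq_zero hdeg hlead horth n n le_rfl r hdr]
    ring
  have hr0 : r = 0 := by
    by_contra hne
    exact (hpos r hne).ne' h0
  have hp : p n = C κ * poly M n := by rw [← sub_eq_zero, ← hr, hr0]
  have h1 : κ ^ 2 * normSq M n = 1 := by
    have h := horth n n
    rw [if_pos rfl, hp, show C κ * poly M n * (C κ * poly M n) =
      C κ * (C κ * (poly M n * poly M n)) by ring, map_C_mul, map_C_mul] at h
    rw [← h, normSq]; ring
  have hκ' : κ = 1 / √(normSq M n) := by
    rw [eq_div_iff (Real.sqrt_pos.2 (normSq_pos hpos n)).ne',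
      ← Real.sqrt_sq (show 0 ≤ κ from (hlead n).le), ← Real.sqrt_mul (sq_nonneg _), h1, Real.sqrt_one]
  rw [← hκ', hp]

lemma existsUnique_isOrthonormalSystem (hpos : ∀ p : ℝ[X], p ≠ 0 → 0 < M (p * p))
    (hM : ∀ q : ℝ[X], HasSum (fun k : ℕ => q.eval (k : ℝ) * w k) (M q)) :
    ∃! p : ℕ → ℝ[X], IsOrthonormalSystem w p := by
  open MomentFunctional in
  refine ⟨fun n => C (1 / √(normSq M n)) * poly M n, ?_, ?_⟩
  · have hs : ∀ n, 0 < 1 / √(normSq M n) := fun n =>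
      one_div_pos.2 (Real.sqrt_pos.2 (normSq_pos hpos n))
    refine (isOrthonormalSystem_iff hM).2 ⟨fun n => ?_, fun n => ?_, fun n m => ?_⟩
    · rw [natDegree_C_mul (hs n).ne', natDegree_poly]
    · rw [leadingCoeff_mul, leadingCoeff_C, (monic_poly M n).leadingCoeff, mul_one]
      exact hs n
    · rw [show ∀ a b : ℝ, C a * poly M n * (C b * poly M m) =
        C a * (C b * (poly M n * poly M m)) by intros; ring, map_C_mul, map_C_mul]
      split_ifs with h
      · subst h
        have hh := normSq_pos hpos m
        have h2 := Real.mul_self_sqrt hh.le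
        have h3 := (Real.sqrt_pos.2 hh).ne'
        change _ * (_ * normSq M m) = 1
        field_simp
        rw [pow_two, h2]
      · rcases Nat.lt_or_gt_of_ne h with h | h
        · rw [orthogonal_le hpos n n le_rfl m h]; ring
        · rw [mul_comm (poly M n), orthogonal_le hpos m m le_rfl n h]; ring
  · intro p hp
    obtain ⟨h1, h2, h3⟩ := (isOrthonormalSystem_iff hM).1 hp
    exact funext fun n => eq_C_mul_poly_of_orthonormal hpos h1 h2 h3 n

end OrthonormalSystem

/-! ### The ladder sum and x_n -/

section LadderParameter

variable {α β γ c : ℝ}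

lemma discretePotential_mul_hypWeight_succ (hα : 0 < α) (hβ : 0 < β) (hγ : 0 < γ) (hc : 0 < c)
    (k : ℕ) : discretePotential α β γ c (k + 1 : ℕ) * hypWeight α β γ c (k + 1) =
      hypWeight α β γ c k - hypWeight α β γ c (k + 1) := by
  have hrec := hypWeight_succ (α := α) (β := β) (c := c) hγ k
  have h1 : α + k ≠ 0 := by positivity
  have h2 : β + k ≠ 0 := by positivity
  unfold discretePotential
  push_cast
  rw [show γ + (k + 1 : ℝ) - 1 = γ + k by ring, show α + (k + 1 : ℝ) - 1 = α + k by ring,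
    show β + (k + 1 : ℝ) - 1 = β + k by ring]
  have hc0 := hc.ne'
  field_simp
  linear_combination hrec

lemma discretePotential_zero (α β γ c : ℝ) : discretePotential α β γ c 0 = -1 := by
  simp [discretePotential]

/-- The denominator-free form remains true at k = 0, where both sides vanish, even if α = 1 or β =
1. -/
lemma discretePotential_nat_mul (hα : 0 < α) (hβ : 0 < β) (hc : 0 < c) (k : ℕ) :
    c * ((α + k - 1) * (β + k - 1)) * (discretePotential α β γ c k + 1) =
      (γ + k - 1) * k := by
  cases k with
  | zero => simp [discretePotential]
  | succ k =>
    have h1 : α + k ≠ 0 := by positivity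
    have h2 : β + k ≠ 0 := by positivity
    unfold discretePotential
    push_cast
    rw [show α + (k + 1 : ℝ) - 1 = α + k by ring, show β + (k + 1 : ℝ) - 1 = β + k by ring]
    have hc0 := hc.ne'
    field_simp
    ring

/-- Summation by parts against the discrete potential. -/
lemma hasSum_mul_discretePotential (hα : 0 < α) (hβ : 0 < β) (hγ : 0 < γ)
    (hc : c ∈ Set.Ioo (0 : ℝ) 1) (g : ℝ[X]) :
    HasSum (fun k : ℕ => g.eval (k : ℝ) * (discretePotential α β γ c k * hypWeight α β γ c k))
      (hypFunctional α β γ c (g.comp (X + C 1)) - hypFunctional α β γ c g) := by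
  rw [← hasSum_nat_add_iff' 1]
  have h1 := hasSum_hypFunctional hα hβ hγ hc (g.comp (X + C 1))
  have h2 := (hasSum_nat_add_iff' 1).2 (hasSum_hypFunctional hα hβ hγ hc g)
  have h := h1.sub h2
  simp only [Finset.sum_range_one] at h ⊢
  convert h using 1
  · ext k
    rw [discretePotential_mul_hypWeight_succ hα hβ hγ hc.1]
    simp only [eval_comp, eval_add, eval_X, eval_C]
    push_cast
    ring
  · rw [Nat.cast_zero, discretePotential_zero]
    ring

/-- The number `x_n` in terms of the recurrence coefficient `b_n`. -/
noncomputable def ladderValue (α β γ c : ℝ) (n : ℕ) : ℝ :=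
  MomentFunctional.recB (hypFunctional α β γ c) n + (γ - n - c * (n + α + β)) / (1 - c)

lemma isLadderParameter_ladderValue (hα : 0 < α) (hβ : 0 < β) (hγ : 0 < γ)
    (hc : c ∈ Set.Ioo (0 : ℝ) 1) {p : ℕ → ℝ[X]} (hp : IsOrthonormalSystem (hypWeight α β γ c) p)
    (n : ℕ) : IsLadderParameter α β γ c (p n) (ladderValue α β γ c n) := by
  open MomentFunctional in
  intro z hzα hzβ hz
  set M := hypFunctional α β γ c with hM
  have hpos := hypFunctional_pos hα hβ hγ hc
  obtain ⟨h1, h2, h3⟩ := (isOrthonormalSystem_iff (hasSum_hypFunctional hα hβ hγ hc)).1 hp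
  have hpn := eq_C_mul_poly_of_orthonormal hpos h1 h2 h3 n
  rw [← hM] at hpn
  set κ := 1 / √(normSq M n) with hκ
  have hh := normSq_pos hpos n
  rw [← hM] at hh
  have hκ2 : κ * κ * normSq M n = 1 := by
    have h4 := Real.mul_self_sqrt hh.le
    have h5 := (Real.sqrt_pos.2 hh).ne'
    rw [hκ]; field_simp; rw [pow_two, h4]
  have val0 : ∀ r : ℝ, M (p n * (p n).comp (X + C r)) = 1 := by
    intro r
    have e : p n * (p n).comp (X + C r) =
        C (κ * κ) * (poly M n * (poly M n).comp (X + C r)) := by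
      rw [hpn, mul_comp, C_comp, C_mul]; ring
    rw [e, map_C_mul, map_poly_mul_comp hpos, hκ2]
  have val1 : ∀ r s : ℝ, M ((X + C s) * (p n * (p n).comp (X + C r))) =
      recB M n + r * n + s := by
    intro r s
    have e : X * (p n * (p n).comp (X + C r)) =
        C (κ * κ) * (X * (poly M n * (poly M n).comp (X + C r))) := by
      rw [hpn, mul_comp, C_comp, C_mul]; ring
    rw [add_mul, map_add, map_C_mul, val0, e, map_C_mul, map_X_mul_poly_mul_comp hpos]
    linear_combination (recB M n + r * n) * hκ2
  have hs1 := (hasSum_hypFunctional hα hβ hγ hc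
    ((X + C (z - 1)) * (p n * (p n).comp (X + C (-1))))).mul_left (1 / c - 1)
  have hs2 := (hasSum_hypFunctional hα hβ hγ hc
    (p n * (p n).comp (X + C (-1)))).mul_left ((γ + 1) / c - α - β)
  have hs3 := hasSum_mul_discretePotential hα hβ hγ hc
    ((X + C (z + α + β - 1)) * (p n * (p n).comp (X + C (-1))))
  have hcomp : ((X + C (z + α + β - 1)) * (p n * (p n).comp (X + C (-1)))).comp (X + C 1) =
      (X + C (z + α + β)) * (p n * (p n).comp (X + C 1)) := by
    rw [mul_comp, mul_comp, show (-1 : ℝ) = -(1 : ℝ) by rfl]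
    have := comp_X_add_C_neg (p n) (-1)
    rw [neg_neg] at this
    rw [this]
    simp only [add_comp, X_comp, C_comp]
    simp only [C_sub, C_add, C_1]
    ring
  rw [hcomp] at hs3
  simp only [← hM] at hs1 hs2 hs3
  rw [val1] at hs1
  rw [val0] at hs2
  rw [val1, val1] at hs3
  have h := ((hs1.add hs2).sub hs3).div_const ((z + α) * (z + β))
  have hzα' : z + α ≠ 0 := fun h => hzα (by linarith)
  have hzβ' : z + β ≠ 0 := fun h => hzβ (by linarith)
  have hc0 : c ≠ 0 := hc.1.ne'
  have hc1 : 1 - c ≠ 0 := (sub_pos.2 hc.2).ne'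
  have hval : (1 - c) / c * ((z + ladderValue α β γ c n) / ((z + α) * (z + β))) =
      ((1 / c - 1) * (recB M n + -1 * n + (z - 1)) + ((γ + 1) / c - α - β) * 1
        - (recB M n + 1 * n + (z + α + β) - (recB M n + -1 * n + (z + α + β - 1)))) /
        ((z + α) * (z + β)) := by
    rw [ladderValue, ← hM]
    field_simp
    ring
  rw [hval]
  refine h.congr_fun fun k => ?_
  have hzk : z + 1 - k ≠ 0 := sub_ne_zero.2 (hz k)
  have hu := discretePotential_nat_mul (γ := γ) hα hβ hc.1 k
  have hv : c * ((z + α) * (z + β)) * (discretePotential α β γ c (z + 1) + 1) =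
      (γ + z) * (z + 1) := by
    unfold discretePotential
    rw [show α + (z + 1) - 1 = z + α by ring, show β + (z + 1) - 1 = z + β by ring]
    field_simp
    ring
  set u := discretePotential α β γ c k
  set v := discretePotential α β γ c (z + 1)
  -- Subtracting the cleared equations for v and u makes z + 1 - k divide out. What is left is
  -- affine in k plus u(k) times an affine function, so the sum splits into `hs1`, `hs2` and the
  -- summation by parts `hs3`.
  have hdiv : (v - u) / (z + 1 - k) = ((1 / c - 1) * (k + (z - 1)) + ((γ + 1) / c - α - β)
      - (k + (z + α + β - 1)) * u) / ((z + α) * (z + β)) := by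
    rw [div_eq_div_iff hzk (mul_ne_zero hzα' hzβ')]
    field_simp
    linear_combination hv - hu
  rw [hdiv]
  simp only [eval_mul, eval_add, eval_X, eval_C, eval_comp]
  rw [show (k : ℝ) + -1 = k - 1 by ring]
  ring

lemma IsLadderParameter.unique (hc : c ∈ Set.Ioo (0 : ℝ) 1) {q : ℝ[X]} {ξ ξ' : ℝ}
    (h : IsLadderParameter α β γ c q ξ) (h' : IsLadderParameter α β γ c q ξ') : ξ = ξ' := by
  -- One admissible z suffices; in (-1, 0) the point z + 1 is never an integer.
  obtain ⟨z, hz, hzn⟩ := (Set.Ioo_infinite (show (-1 : ℝ) < 0 by norm_num)).exists_notMem_finset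
    {-α, -β}
  simp only [Finset.mem_insert, Finset.mem_singleton, not_or] at hzn
  have hk : ∀ k : ℕ, z + 1 ≠ (k : ℝ) := by
    intro k hk
    have h1 : (0 : ℝ) < k := by rw [← hk]; linarith [hz.1]
    have h2 : (k : ℝ) < 1 := by rw [← hk]; linarith [hz.2]
    have h3 : 0 < k := by exact_mod_cast h1
    have h4 : k < 1 := by exact_mod_cast h2
    omega
  have hzα' : z + α ≠ 0 := fun h => hzn.1 (by linarith)
  have hzβ' : z + β ≠ 0 := fun h => hzn.2 (by linarith)
  have hc0 : c ≠ 0 := hc.1.ne'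
  have hc1 : 1 - c ≠ 0 := (sub_pos.2 hc.2).ne'
  have e := (h z hzn.1 hzn.2 hk).unique (h' z hzn.1 hzn.2 hk)
  have e1 := mul_left_cancel₀ (div_ne_zero hc1 hc0) e
  rw [div_left_inj' (mul_ne_zero hzα' hzβ')] at e1
  linarith

end LadderParameter

/-- The factor c - 1 cancels the denominators, so the corrections to b_k add up to an affine
function of c. This accounts for the difference between K, L and `sigmaSlope`, `sigmaShift`. -/
lemma sum_ladderValue {α β γ c : ℝ} (hc : c ∈ Set.Ioo (0 : ℝ) 1) (n : ℕ) :
    (c - 1) * ∑ k ∈ Finset.range n, ladderValue α β γ c k =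
      (c - 1) * MomentFunctional.sumB (hypFunctional α β γ c) n
        - n * γ + c * n * (α + β) + (1 + c) * (n * (n - 1) / 2) := by
  have hc1 : 1 - c ≠ 0 := (sub_pos.2 hc.2).ne'
  induction n with
  | zero => simp
  | succ n ih =>
    rw [Finset.sum_range_succ, mul_add, ih, MomentFunctional.sumB_succ, ladderValue]
    push_cast
    field_simp
    ring

theorem theorem2 (α β γ : ℝ) (hα : 0 < α) (hβ : 0 < β) (hγ : 0 < γ) :
    -- the orthonormal polynomials `p_n` and the numbers `x_n` are well defined
    (∀ c ∈ Set.Ioo (0 : ℝ) 1,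
      ∃! p : ℕ → Polynomial ℝ, IsOrthonormalSystem (hypWeight α β γ c) p) ∧
    (∀ c ∈ Set.Ioo (0 : ℝ) 1, ∀ p : ℕ → Polynomial ℝ,
      IsOrthonormalSystem (hypWeight α β γ c) p →
        ∀ n : ℕ, ∃! ξ : ℝ, IsLadderParameter α β γ c (p n) ξ) ∧
    -- and `σ_n` solves the `σ`-form of the sixth Painlevé equation
    (∀ p : ℝ → ℕ → Polynomial ℝ,
      (∀ c ∈ Set.Ioo (0 : ℝ) 1, IsOrthonormalSystem (hypWeight α β γ c) (p c)) →
      ∀ x : ℕ → ℝ → ℝ,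
        (∀ n : ℕ, ∀ c ∈ Set.Ioo (0 : ℝ) 1, IsLadderParameter α β γ c (p c n) (x n c)) →
        ∀ n : ℕ,
          IsSigmaPVISolutionOn
            (((n : ℝ) + α - β) / 2) ((-(n : ℝ) + α - β) / 2)
            (((n : ℝ) + α + β - 2) / 2) (((n : ℝ) + α + β - 2 * γ) / 2)
            (sigmaFn α β γ x n) (Set.Ioo (0 : ℝ) 1)) := by
  refine ⟨fun c hc => ?_, fun c hc p hp n => ?_, fun p hp x hx n => ?_⟩
  · exact existsUnique_isOrthonormalSystem (hypFunctional_pos hα hβ hγ hc)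
      (hasSum_hypFunctional hα hβ hγ hc)
  · have h := isLadderParameter_ladderValue hα hβ hγ hc hp n
    exact ⟨_, h, fun ξ hξ => hξ.unique hc h⟩
  · refine (isHypergeometricFamily_hypFunctional hα hβ hγ).isSigmaPVISolutionOn n fun c hc => ?_
    have hxk : ∀ k, x k c = ladderValue α β γ c k := fun k =>
      (hx k c hc).unique hc (isLadderParameter_ladderValue hα hβ hγ hc (hp c hc) k)
    rw [sigmaFn, Finset.sum_congr rfl fun k _ => hxk k, sum_ladderValue hc,
      MomentFunctional.sigmaSlope, MomentFunctional.sigmaShift]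
    ring
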